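/- All graphs are finite and simple. Let $G$ be a 2-connected graph on $n$ vertices (at least three vertices, connected, and connected after the deletion of any one vertex), let $k\ge 0$ be an integer with $\delta(G)\geq k$, and let $C$ be a cycle of length $c\leq n-1$ in $G$. Suppose that $C$ is locally maximal, that is, there is no cycle $C'$ in $G$ with $|E(C')|>|E(C)|$ such that at most two edges of $C'$ have exactly one end in $V(C)$. If the clique number of the induced subgraph $G[V(C)]$ is at least $c-k+1$, then $G$ is isomorphic to $W_{n,k,c}$ or to $Z_{n,k,c}$ (in particular, the parameters are such that the graph in question exists). Here: - $W_{n,k,c}$, defined when $k\le c-k+1\le n$, is the graph obtained from a clique $K_{c-k+1}$ by adding $n-(c-k+1)$ pairwise non-adjacent new vertices, each joined to exactly the same $k$ vertices of the clique. - $Z_{n,k,c}$, defined when $k\ge 2$, $2\le c-k+1\le n$ and $k-1$ divides $n-(c-k+1)$, is the union of one clique $K_{c-k+1}$ and $\frac{n-(c-k+1)}{k-1}$ cliques $K_{k+1}$ such that any two of these cliques share exactly the same two vertices. -/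

import Mathlib

namespace Circumference

/-- A graph is 2-connected if it has at least three vertices, is connected, and stays connected
after the deletion of any one vertex. -/
def TwoConnected {V : Type*} [Fintype V] (G : SimpleGraph V) : Prop :=
  3 ≤ Fintype.card V ∧ G.Connected ∧ ∀ v : V, (G.induce {v}ᶜ).Connected

/-- The vertex set of a closed walk. -/
def vertexSet {V : Type*} {G : SimpleGraph V} {v : V} (C : G.Walk v v) : Set V :=
  {x | x ∈ C.support}

/-- `E(C, G - C)`: the edges of `G` with one end on `C` and the other end off `C`. -/
def crossingEdges {V : Type*} {G : SimpleGraph V} {v : V} (C : G.Walk v v) : Set (Sym2 V) :=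
  {e | ∃ x y : V, x ∈ vertexSet C ∧ y ∉ vertexSet C ∧ G.Adj x y ∧ e = s(x, y)}

/-- A cycle `C` is locally maximal in `G` if no cycle `C'` of `G` is longer than `C` and
has at most two edges in `E(C, G - C)`. -/
def IsLocallyMaximalCycle {V : Type*} {G : SimpleGraph V} {v : V} (C : G.Walk v v) : Prop :=
  C.IsCycle ∧
    ¬ ∃ (w : V) (C' : G.Walk w w), C'.IsCycle ∧ C.length < C'.length ∧
      ({e | e ∈ C'.edges} ∩ crossingEdges C).ncard ≤ 2

/-- The graph `W_{n,k,c}` (meaningful when `k ≤ c - k + 1 ≤ n`): the vertices `0, …, c - k` form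
a clique, and each other vertex is joined exactly to the `k` clique vertices `0, …, k - 1`. -/
def graphW (n k c : ℕ) : SimpleGraph (Fin n) where
  Adj i j := i ≠ j ∧
    ((i.val < c + 1 - k ∧ j.val < c + 1 - k) ∨
      (i.val < k ∧ c + 1 - k ≤ j.val) ∨ (j.val < k ∧ c + 1 - k ≤ i.val))
  symm := ⟨fun i j h => ⟨h.1.symm, by tauto⟩⟩
  loopless := ⟨fun _ h => h.1 rfl⟩

/-- The clique of `Z_{n,k,c}` in which the vertex `i ≥ 2` lies: clique number `0` is
the big clique `K_{c-k+1}`; the vertices `i ≥ c - k + 1` are distributed, `k - 1` at a time and in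
increasing order, over the cliques `K_{k+1}`, which have the numbers `1, 2, …`. -/
def blockZ (k c i : ℕ) : ℕ :=
  if i < c + 1 - k then 0 else (i - (c + 1 - k)) / (k - 1) + 1

/-- The graph `Z_{n,k,c}` (meaningful when `2 ≤ k`, `2 ≤ c - k + 1 ≤ n` and `k - 1` divides
`n - (c - k + 1)`): the union of a clique `K_{c-k+1}` and of `(n - (c - k + 1)) / (k - 1)` cliques
`K_{k+1}`, any two of which share exactly the two vertices `0` and `1`. -/
def graphZ (n k c : ℕ) : SimpleGraph (Fin n) where
  Adj i j := i ≠ j ∧ (i.val < 2 ∨ j.val < 2 ∨ blockZ k c i.val = blockZ k c j.val)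
  symm := ⟨fun i j h => ⟨h.1.symm, by have := h.2; tauto⟩⟩
  loopless := ⟨fun _ h => h.1 rfl⟩

/-- `G` is (isomorphic to) `W_{n,k,c}`, for parameters for which that graph exists. -/
def IsW {V : Type*} (G : SimpleGraph V) (n k c : ℕ) : Prop :=
  k ≤ c ∧ k ≤ c - k + 1 ∧ c - k + 1 ≤ n ∧ Nonempty (G ≃g graphW n k c)

/-- `G` is (isomorphic to) `Z_{n,k,c}`, for parameters for which that graph exists. -/
def IsZ {V : Type*} (G : SimpleGraph V) (n k c : ℕ) : Prop :=
  2 ≤ k ∧ k ≤ c ∧ 2 ≤ c - k + 1 ∧ c - k + 1 ≤ n ∧ (k - 1) ∣ (n - (c - k + 1)) ∧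
    Nonempty (G ≃g graphZ n k c)

end Circumference

namespace Circumference

open SimpleGraph

variable {V : Type*} {G : SimpleGraph V}

/-! A path off `C` on p vertices, joined at its ends to distinct vertices u and w of `C`, closes up
with any u-w-path on V(C) to a cycle with only two crossing edges. Local maximality therefore says
that every u-w-path on V(C) leaves out at least p vertices of `C`; this is `Opposed`, the only form
in which local maximality is used later. Rerouting `C` along one chord shows that the successors of
pairwise opposed vertices are pairwise non-adjacent, and so are the predecessors; a clique contains
at most one vertex of each family.

Fix a clique K on V(C) that misses at most k - 1 vertices of `C`. Counting missed vertices
(`add_card_le_missing_add`) gives the central inequality `path_bound`: if a path of length m off `C`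
leads from x to y, if w on `C` is adjacent to y, and if x has a neighbour on `C` other than w, then
m + 1 + |N_C(x) \ {w}| ≤ k. It becomes strict if N_C(x) = N_C(y), m ≥ 1 and x has two neighbours on
`C` besides w.

Opposite bounds on m come from an Erdős–Gallai theorem for paths with prescribed ends
(`card_lt_or_exists_pathIn`, `exists_pathIn_of_le_degIn`): in a component H of G - C whose vertices
have at most D neighbours on `C`, the degrees inside H are at least k - D. If |H| ≥ 2, the two
bounds force D = 2 and make H a clique on k - 1 vertices, all joined to the same two vertices of `C`
(`comp_structure`). An isolated vertex of G - C has exactly k neighbours on `C`.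

In both cases the count is tight, which locates the k - 1 missed vertices: they fill one arc between
the two attachments, or they alternate with the k attachments (`missed_of_comp`,
`missed_of_isolated`). One more rerouting, now through K, confines their neighbours, and the minimum
degree then gives them the same adjacencies as the vertices off `C`. The two types cannot coexist,
because missed vertices are adjacent to each other in one case and never in the other. Isolated
vertices lead to W, larger components to Z. -/

/-- There is a path of length `m` from `x` to `y` inside the vertex set `S`. -/
def PathIn (G : SimpleGraph V) (S : Set V) (x y : V) (m : ℕ) : Prop :=
  ∃ p : G.Walk x y, p.IsPath ∧ p.length = m ∧ ∀ v ∈ p.support, v ∈ S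

/-! ### Paths confined to a vertex set -/

namespace PathIn

variable {S T : Set V} {x y z w : V} {m l : ℕ}

theorem single (hx : x ∈ S) : PathIn G S x x 0 :=
  ⟨Walk.nil, by simp, rfl, by simpa using hx⟩

theorem mono (h : PathIn G S x y m) (hST : S ⊆ T) : PathIn G T x y m := by
  obtain ⟨p, hp, hl, hs⟩ := h
  exact ⟨p, hp, hl, fun v hv => hST (hs v hv)⟩

theorem symm (h : PathIn G S x y m) : PathIn G S y x m := by
  obtain ⟨p, hp, hl, hs⟩ := h
  exact ⟨p.reverse, hp.reverse, by simpa using hl, fun v hv => hs v (by simpa using hv)⟩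

theorem start_mem (h : PathIn G S x y m) : x ∈ S := by
  obtain ⟨p, -, -, hs⟩ := h
  exact hs x p.start_mem_support

theorem pos (h : PathIn G S x y m) (hxy : x ≠ y) : 1 ≤ m := by
  obtain ⟨p, -, hl, -⟩ := h
  rcases Nat.eq_zero_or_pos m with h0 | h0
  · exact absurd (Walk.eq_of_length_eq_zero (hl.trans h0)) hxy
  · exact h0

theorem link (h₁ : PathIn G S x y m) (hyz : G.Adj y z) (h₂ : PathIn G T z w l)
    (hd : ∀ v ∈ S, v ∉ T) : PathIn G (S ∪ T) x w (m + l + 1) := by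
  obtain ⟨p, hp, hpl, hps⟩ := h₁
  obtain ⟨q, hq, hql, hqs⟩ := h₂
  refine ⟨p.append (Walk.cons hyz q), ?_, ?_, ?_⟩
  · rw [Walk.isPath_def, Walk.support_append, Walk.support_cons, List.tail_cons,
      List.nodup_append]
    refine ⟨hp.support_nodup, hq.support_nodup, ?_⟩
    intro a ha b hb hab
    exact hd a (hps a ha) (hab ▸ hqs b hb)
  · simp [hpl, hql]; omega
  · intro v hv
    rw [Walk.support_append, Walk.support_cons, List.tail_cons, List.mem_append] at hv
    rcases hv with hv | hv
    · exact Or.inl (hps v hv)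
    · exact Or.inr (hqs v hv)

theorem cons (hxy : G.Adj x y) (h : PathIn G S y z m) (hx : x ∉ S) :
    PathIn G (insert x S) x z (m + 1) := by
  have := (single (G := G) (Set.mem_singleton x)).link hxy h
    (by rintro v rfl; exact hx)
  rwa [Set.singleton_union, Nat.zero_add] at this

theorem edge (hxy : G.Adj x y) (hx : x ∈ S) (hy : y ∈ S) : PathIn G S x y 1 := by
  have := cons hxy (single (G := G) (Set.mem_singleton y)) (by simpa using hxy.ne)
  refine this.mono ?_
  rintro v (rfl | rfl) <;> assumption

end PathIn

/-! ### Local maximality, cyclic listings and opposed vertices -/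

/-- A path off a locally maximal cycle `C` and a path on the vertices of `C`, joined at both ends,
have together at most as many vertices as `C`. -/
theorem IsLocallyMaximalCycle.add_le {v : V} {C : G.Walk v v} (hC : IsLocallyMaximalCycle C)
    {S : Set V} (hS : ∀ s ∈ S, s ∉ vertexSet C) {x y u w : V} {p q : ℕ}
    (hP : PathIn G S x y p) (hQ : PathIn G (vertexSet C) u w q) (huw : u ≠ w)
    (hxu : G.Adj x u) (hyw : G.Adj y w) : p + q + 2 ≤ C.length := by
  by_contra hlt
  apply hC.2
  obtain ⟨P, hPp, hPl, hPs⟩ := hP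
  obtain ⟨Q, hQp, hQl, hQs⟩ := hQ
  have hR : (P.append (Walk.cons hyw Q.reverse)).IsPath := by
    rw [Walk.isPath_def, Walk.support_append, Walk.support_cons, List.tail_cons,
      List.nodup_append]
    refine ⟨hPp.support_nodup, hQp.reverse.support_nodup, ?_⟩
    intro a ha b hb hab
    refine hS a (hPs a ha) (hab ▸ hQs b ?_)
    simpa using hb
  have hPe : ∀ e ∈ P.edges, ∀ a ∈ e, a ∉ vertexSet C := by
    intro e he a ha
    exact hS a (hPs a (Walk.mem_support_of_mem_edges he ha))
  have hQe : ∀ e ∈ Q.edges, ∀ a ∈ e, a ∈ vertexSet C := by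
    intro e he a ha
    exact hQs a (Walk.mem_support_of_mem_edges he ha)
  have hx : x ∉ vertexSet C := hS x (hPs x P.start_mem_support)
  have hy : y ∉ vertexSet C := hS y (hPs y P.end_mem_support)
  have hu : u ∈ vertexSet C := hQs u Q.start_mem_support
  have hw : w ∈ vertexSet C := hQs w Q.end_mem_support
  refine ⟨u, Walk.cons hxu.symm (P.append (Walk.cons hyw Q.reverse)), ?_, ?_, ?_⟩
  · rw [Walk.cons_isCycle_iff]
    refine ⟨hR, ?_⟩
    rw [Walk.edges_append, Walk.edges_cons, Walk.edges_reverse, List.mem_append, List.mem_cons,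
      List.mem_reverse]
    rintro (h | h | h)
    · exact hPe _ h u (by simp) hu
    · rw [Sym2.eq_iff] at h
      rcases h with ⟨h, -⟩ | ⟨h, -⟩
      · exact hy (h ▸ hu)
      · exact huw h
    · exact hx (hQe _ h x (by simp))
  · simp [hPl, hQl]; omega
  -- Edges of `P` avoid the cycle and edges of `Q` have both ends on it, so only the two joining
  -- edges can cross.
  · refine (Set.ncard_le_ncard (t := {s(u, x), s(y, w)}) ?_ (by simp)).trans
      ((Set.ncard_insert_le _ _).trans (by simp))
    rintro e ⟨he, a, b, ha, hb, -, rfl⟩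
    simp only [Walk.edges_append, Walk.edges_cons, Walk.edges_reverse, List.mem_append,
      List.mem_cons, List.mem_reverse, Set.mem_ofPred_eq] at he
    rcases he with h | h | h | h
    · exact Or.inl h
    · exact absurd ha (hPe _ h a (by simp))
    · exact Or.inr h
    · exact absurd (hQe _ h b (by simp)) hb

/-- `a 0, …, a (c - 1)` lists the set `S` without repetitions, and consecutive vertices are adjacent
cyclically. -/
structure IsCyclicListing (G : SimpleGraph V) (S : Set V) (c : ℕ) (a : ℕ → V) : Prop where
  adj : ∀ i, G.Adj (a i) (a (i + 1))
  per : ∀ i, a (i + c) = a i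
  inj : ∀ i j, i < c → j < c → a i = a j → i = j
  mem : ∀ v, v ∈ S ↔ ∃ i < c, a i = v

theorem IsCyclicListing.of_isCycle {v : V} {C : G.Walk v v} (hC : C.IsCycle) :
    IsCyclicListing G (vertexSet C) C.length (fun i => C.getVert (i % C.length)) where
  adj i := by
    have hlen := hC.three_le_length
    have hi : i % C.length < C.length := Nat.mod_lt _ (by omega)
    have h := C.adj_getVert_succ hi
    rcases Nat.lt_or_ge (i % C.length + 1) C.length with h1 | h1
    · rwa [Nat.add_mod, Nat.mod_eq_of_lt (show 1 < C.length by omega), Nat.mod_eq_of_lt h1]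
    · have h2 : i % C.length + 1 = C.length := by omega
      rw [Nat.add_mod, Nat.mod_eq_of_lt (show 1 < C.length by omega), h2, Nat.mod_self,
        Walk.getVert_zero]
      rwa [h2, Walk.getVert_length] at h
  per i := by simp
  inj i j hi hj h := by
    simp only [Nat.mod_eq_of_lt hi, Nat.mod_eq_of_lt hj] at h
    exact hC.getVert_injOn' (by simp; omega) (by simp; omega) h
  mem x := by
    have hlen := hC.three_le_length
    constructor
    · intro hx
      obtain ⟨i, hi, hil⟩ := Walk.mem_support_iff_exists_getVert.1 hx
      rcases Nat.lt_or_ge i C.length with h | h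
      · exact ⟨i, h, by simpa [Nat.mod_eq_of_lt h] using hi⟩
      · have : i = C.length := by omega
        subst this
        exact ⟨0, by omega, by simpa using hi⟩
    · rintro ⟨i, hi, rfl⟩
      exact C.getVert_mem_support _

/-- A bound on the length of all paths from `u` to `w` inside `S`, `|S| = c`: they leave out at least
`p` vertices. -/
def Opposed (G : SimpleGraph V) (S : Set V) (c p : ℕ) (u w : V) : Prop :=
  ∀ q, PathIn G S u w q → p + q + 1 ≤ c

theorem Opposed.symm {S : Set V} {c p : ℕ} {u w : V} (h : Opposed G S c p u w) :
    Opposed G S c p w u := fun q hq => h q hq.symm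

theorem Opposed.mono {S : Set V} {c p p' : ℕ} {u w : V} (h : Opposed G S c p u w) (hp : p' ≤ p) :
    Opposed G S c p' u w := fun q hq => by have := h q hq; omega

namespace IsCyclicListing

variable {S : Set V} {c p : ℕ} {a : ℕ → V} (ha : IsCyclicListing G S c a)
include ha

theorem apply_mod (i : ℕ) : a (i % c) = a i := by
  conv_rhs => rw [← Nat.mod_add_div i c]
  generalize i / c = d
  induction d with
  | zero => simp
  | succ d ih => rw [Nat.mul_succ, ← add_assoc, ha.per, ih]

theorem mem_apply (hc : 0 < c) (i : ℕ) : a i ∈ S :=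
  (ha.mem _).2 ⟨i % c, Nat.mod_lt _ hc, ha.apply_mod i⟩

theorem rotate (hc : 0 < c) (r : ℕ) : IsCyclicListing G S c (fun i => a (i + r)) where
  adj i := by
    have := ha.adj (i + r)
    rwa [show i + r + 1 = i + 1 + r by omega] at this
  per i := by rw [show i + c + r = i + r + c by omega, ha.per]
  inj i j hi hj h := by
    have h' := ha.inj _ _ (Nat.mod_lt _ hc) (Nat.mod_lt _ hc)
      (((ha.apply_mod _).trans h).trans (ha.apply_mod _).symm)
    have := Nat.ModEq.add_right_cancel' r h'
    rwa [Nat.ModEq, Nat.mod_eq_of_lt hi, Nat.mod_eq_of_lt hj] at this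
  mem v := by
    constructor
    · intro hv
      obtain ⟨i, hi, rfl⟩ := (ha.mem v).1 hv
      -- Rotation backwards by `r`, with `r` reduced modulo `c` so that the natural subtraction does
      -- not truncate.
      refine ⟨(i + (c - r % c)) % c, Nat.mod_lt _ hc, ?_⟩
      rw [← ha.apply_mod, ← ha.apply_mod i]
      congr 1
      have h1 := Nat.mod_lt r hc
      have h2 := Nat.mod_add_div r c
      rw [Nat.mod_add_mod]
      have : i + (c - r % c) + r = i + c * (r / c + 1) := by
        rw [Nat.mul_add]; omega
      rw [this, Nat.add_mul_mod_self_left]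
    · rintro ⟨i, -, rfl⟩
      exact ha.mem_apply hc _

theorem arc {i j : ℕ} (hij : i ≤ j) (hj : j < c) :
    PathIn G (a '' Set.Icc i j) (a i) (a j) (j - i) := by
  induction j, hij using Nat.le_induction with
  | base => simpa using PathIn.single (G := G) (Set.mem_singleton (a i))
  | succ j hij ih =>
    have h := (ih (by omega)).link (ha.adj j)
      (PathIn.single (G := G) (Set.mem_singleton (a (j + 1)))) (by
        rintro _ ⟨l, hl, rfl⟩ h
        have := ha.inj _ _ (by have := hl.2; omega) hj h
        have := hl.2
        omega)
    rw [show j + 1 - i = j - i + 0 + 1 by omega]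
    refine h.mono ?_
    rintro _ (⟨l, hl, rfl⟩ | rfl)
    · exact ⟨l, ⟨hl.1, by have := hl.2; omega⟩, rfl⟩
    · exact ⟨j + 1, ⟨by omega, le_rfl⟩, rfl⟩

theorem disjoint_image {s t : Set ℕ} (hs : ∀ i ∈ s, i < c) (ht : ∀ i ∈ t, i < c)
    (hst : ∀ i ∈ s, i ∉ t) : ∀ v ∈ a '' s, v ∉ a '' t := by
  rintro _ ⟨i, hi, rfl⟩ ⟨j, hj, h⟩
  exact hst i hi (ha.inj _ _ (ht j hj) (hs i hi) h ▸ hj)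

theorem wrap {i j : ℕ} (hij : i < j) (hj : j < c) :
    PathIn G (a '' (Set.Icc j (c - 1) ∪ Set.Icc 0 i)) (a j) (a i) (c - j + i) := by
  have hadj : G.Adj (a (c - 1)) (a 0) := by
    have := ha.adj (c - 1)
    rwa [show c - 1 + 1 = 0 + c by omega, ha.per] at this
  have h := (ha.arc (show j ≤ c - 1 by omega) (by omega)).link hadj
    (ha.arc (Nat.zero_le i) (by omega)) (ha.disjoint_image
      (by rintro l ⟨h1, h2⟩; omega) (by rintro l ⟨h1, h2⟩; omega)
      (by rintro l ⟨h1, h2⟩ ⟨h3, h4⟩; omega))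
  rw [Set.image_union]
  convert h using 1
  omega

theorem image_subset (hc : 0 < c) (s : Set ℕ) : a '' s ⊆ S := by
  rintro _ ⟨i, -, rfl⟩
  exact ha.mem_apply hc i

/-- Both arcs of the cycle between the two vertices are paths, and each leaves out exactly the
interior of the other. -/
theorem gap {i j : ℕ} (hij : i < j) (hj : j < c) (h : Opposed G S c p (a i) (a j)) :
    i + p + 1 ≤ j ∧ p + j + 1 ≤ c + i := by
  have h1 := h _ ((ha.arc hij.le hj).mono (ha.image_subset (by omega) _))
  have h2 := h _ ((ha.wrap hij hj).symm.mono (ha.image_subset (by omega) _))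
  omega

/-- The path from `a j` back to `a s`, over the chord to `a t` and onwards around to `a i` leaves
out only the (s - i - 1) + (t - j - 1) vertices just after `a i` and just after `a j`. -/
theorem chord_after {i j s t : ℕ} (his : i < s) (hsj : s < j) (hjt : j < t) (ht : t < c)
    (h : Opposed G S c p (a i) (a j)) (hst : G.Adj (a s) (a t)) : p + i + j + 2 ≤ s + t := by
  have h1 := (ha.arc hsj.le (by omega)).symm.link hst (ha.wrap (show i < t by omega) ht)
    (ha.disjoint_image (by rintro l ⟨h1, h2⟩; omega)
      (by rintro l (⟨h1, h2⟩ | ⟨h1, h2⟩) <;> omega)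
      (by rintro l ⟨h1, h2⟩ (⟨h3, h4⟩ | ⟨h3, h4⟩) <;> omega))
  have := h.symm _ (h1.mono (Set.union_subset (ha.image_subset (by omega) _)
    (ha.image_subset (by omega) _)))
  omega

/-- Mirror image of `chord_after`: the path from `a i` on to `a s`, over the chord and back to `a j`
leaves out only the vertices between `s` and `j` and those cyclically between `t` and `i`. -/
theorem chord_before {i j s t : ℕ} (his : i < s) (hsj : s < j) (hjt : j < t) (ht : t < c)
    (h : Opposed G S c p (a i) (a j)) (hst : G.Adj (a s) (a t)) : p + s + t + 2 ≤ c + i + j := by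
  have h1 := (ha.arc his.le (by omega)).link hst (ha.arc hjt.le ht).symm
    (ha.disjoint_image (by rintro l ⟨h1, h2⟩; omega)
      (by rintro l ⟨h1, h2⟩; omega)
      (by rintro l ⟨h1, h2⟩ ⟨h3, h4⟩; omega))
  have := h _ (h1.mono (Set.union_subset (ha.image_subset (by omega) _)
    (ha.image_subset (by omega) _)))
  omega

end IsCyclicListing

/-! ### Counting the cycle vertices missed by a clique -/

open Classical in
/-- The indices in the listing `a` of the vertices that are not in `K`. -/
noncomputable def missing (a : ℕ → V) (c : ℕ) (K : Set V) : Finset ℕ :=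
  (Finset.range c).filter (fun i => a i ∉ K)

theorem mem_missing {a : ℕ → V} {c : ℕ} {K : Set V} {i : ℕ} :
    i ∈ missing a c K ↔ i < c ∧ a i ∉ K := by
  simp [missing]

namespace IsCyclicListing

variable {S : Set V} {c p : ℕ} {a : ℕ → V} (ha : IsCyclicListing G S c a)
include ha

/-- The case of `chord_before` in which the end of the chord outside the arc lies before `a i` in
the listing, so that the path itself passes index 0. -/
theorem chord_before_wrap {i j s t : ℕ} (hti : t < i) (his : i < s) (hsj : s < j) (hj : j < c)
    (h : Opposed G S c p (a i) (a j)) (hst : G.Adj (a s) (a t)) : p + s + t + 2 ≤ i + j := by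
  have h1 := (ha.arc his.le (by omega)).link hst (ha.wrap (show t < j by omega) hj).symm
    (ha.disjoint_image (by rintro l ⟨h1, h2⟩; omega)
      (by rintro l (⟨h1, h2⟩ | ⟨h1, h2⟩) <;> omega)
      (by rintro l ⟨h1, h2⟩ (⟨h3, h4⟩ | ⟨h3, h4⟩) <;> omega))
  have := h _ (h1.mono (Set.union_subset (ha.image_subset (by omega) _)
    (ha.image_subset (by omega) _)))
  omega

/-- With this chord the rerouted path of `chord_after` would leave out no vertex at all. -/
theorem not_adj_succ {i j : ℕ} (hij : i < j) (hj : j + 1 < c)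
    (h : Opposed G S c 1 (a i) (a j)) : ¬ G.Adj (a (i + 1)) (a (j + 1)) := by
  intro hadj
  have h1 := ha.gap hij (by omega) h
  have := ha.chord_after (show i < i + 1 by omega) (by omega) (show j < j + 1 by omega) hj h hadj
  omega

theorem not_adj_pred {i j : ℕ} (hi : 0 < i) (hij : i < j) (hj : j < c)
    (h : Opposed G S c 1 (a i) (a j)) : ¬ G.Adj (a (i - 1)) (a (j - 1)) := by
  intro hadj
  have h1 := ha.gap hij hj h
  have := ha.chord_before_wrap (show i - 1 < i by omega) (show i < j - 1 by omega) (by omega) hj h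
    hadj.symm
  omega

theorem not_adj_pred_zero {i : ℕ} (hi : 0 < i) (hic : i < c)
    (h : Opposed G S c 1 (a 0) (a i)) : ¬ G.Adj (a (i - 1)) (a (c - 1)) := by
  intro hadj
  have h1 := ha.gap hi hic h
  have := ha.chord_before (show 0 < i - 1 by omega) (by omega) (show i < c - 1 by omega)
    (by omega) h hadj
  omega

/-- A clique contains at most one vertex of an independent set, so it misses all the others. -/
theorem card_le_missing_succ {K : Set V} (hK : G.IsClique K) {E : Finset ℕ}
    (hE : ∀ e ∈ E, e < c) (hEn : ∀ e ∈ E, ∀ f ∈ E, e < f → ¬ G.Adj (a e) (a f)) :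
    E.card ≤ (E ∩ missing a c K).card + 1 := by
  classical
  rw [← Finset.card_inter_add_card_sdiff E (missing a c K)]
  have : (E \ missing a c K).card ≤ 1 := by
    rw [Finset.card_le_one]
    have key : ∀ e ∈ E \ missing a c K, ∀ f ∈ E \ missing a c K, ¬ e < f := by
      intro e he f hf hef
      simp only [Finset.mem_sdiff, mem_missing, not_and, not_not] at he hf
      refine hEn e he.1 f hf.1 hef (hK (he.2 (hE e he.1)) (hf.2 (hE f hf.1)) ?_)
      intro h
      have := ha.inj _ _ (hE e he.1) (hE f hf.1) h
      omega
    intro e he f hf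
    have h1 := key e he f hf
    have h2 := key f hf e he
    omega
  omega

/-- The clique meets both arcs between two opposed vertices only if it misses many vertices. -/
theorem two_mul_le_of_hit {K : Set V} (hK : G.IsClique K) {i j : ℕ} (hij : i ≤ j)
    (h0i : Opposed G S c p (a 0) (a i)) (h0j : Opposed G S c p (a 0) (a j))
    (hA : ∃ s, 0 < s ∧ s < i ∧ a s ∈ K) (hB : ∃ t, j < t ∧ t < c ∧ a t ∈ K) :
    2 * p ≤ (missing a c K ∩ (Finset.Ioo 0 i ∪ Finset.Ioo j c)).card := by
  classical
  obtain ⟨s₀, hs₀, hs₀min⟩ := Finset.exists_min_image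
    ((Finset.Ioo 0 i).filter (fun s => a s ∈ K)) id
    (by obtain ⟨s, h1, h2, h3⟩ := hA; exact ⟨s, by simp [h1, h2, h3]⟩)
  obtain ⟨s₁, hs₁, hs₁max⟩ := Finset.exists_max_image
    ((Finset.Ioo 0 i).filter (fun s => a s ∈ K)) id
    (by obtain ⟨s, h1, h2, h3⟩ := hA; exact ⟨s, by simp [h1, h2, h3]⟩)
  obtain ⟨t₀, ht₀, ht₀min⟩ := Finset.exists_min_image
    ((Finset.Ioo j c).filter (fun s => a s ∈ K)) id
    (by obtain ⟨s, h1, h2, h3⟩ := hB; exact ⟨s, by simp [h1, h2, h3]⟩)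
  obtain ⟨t₁, ht₁, ht₁max⟩ := Finset.exists_max_image
    ((Finset.Ioo j c).filter (fun s => a s ∈ K)) id
    (by obtain ⟨s, h1, h2, h3⟩ := hB; exact ⟨s, by simp [h1, h2, h3]⟩)
  simp only [Finset.mem_filter, Finset.mem_Ioo, id, and_imp] at *
  have hadj : ∀ s t, 0 < s → s < i → j < t → t < c → a s ∈ K → a t ∈ K → G.Adj (a s) (a t) := by
    intro s t h1 h2 h3 h4 hs ht
    refine hK hs ht fun h => ?_
    have := ha.inj _ _ (by omega) h4 h
    omega
  -- The chord between the first clique vertices of the two arcs bypasses only missed vertices,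
  -- those before its ends, so there are at least `p` of these. The chord between the last clique
  -- vertices does the same for the missed vertices after its ends; the two groups are disjoint.
  have e1 := ha.chord_after (show 0 < s₀ by omega) (by omega) (show j < t₀ by omega) (by omega) h0j
    (hadj _ _ (by omega) (by omega) (by omega) (by omega) hs₀.2 ht₀.2)
  have e2 := ha.chord_before (show 0 < s₁ by omega) (by omega) (show i < t₁ by omega) (by omega) h0i
    (hadj _ _ (by omega) (by omega) (by omega) (by omega) hs₁.2 ht₁.2)
  have hs01 := hs₀min s₁ hs₁.1.1 hs₁.1.2 hs₁.2
  have ht01 := ht₀min t₁ ht₁.1.1 ht₁.1.2 ht₁.2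
  have hsub : (Finset.Ioo 0 s₀ ∪ Finset.Ioo s₁ i) ∪ (Finset.Ioo j t₀ ∪ Finset.Ioo t₁ c) ⊆
      missing a c K ∩ (Finset.Ioo 0 i ∪ Finset.Ioo j c) := by
    intro l hl
    simp only [Finset.mem_union, Finset.mem_Ioo, Finset.mem_inter, mem_missing] at hl ⊢
    refine ⟨⟨by omega, fun hlK => ?_⟩, by omega⟩
    rcases Nat.lt_or_ge l i with h | h
    · have h1 := hs₀min l (by omega) h hlK
      have h2 := hs₁max l (by omega) h hlK
      omega
    · have h1 := ht₀min l (by omega) (by omega) hlK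
      have h2 := ht₁max l (by omega) (by omega) hlK
      omega
  refine le_trans ?_ (Finset.card_le_card hsub)
  rw [Finset.card_union_of_disjoint, Finset.card_union_of_disjoint, Finset.card_union_of_disjoint]
  · simp only [Nat.card_Ioo]
    omega
  all_goals
    rw [Finset.disjoint_left]
    intro l hl
    simp only [Finset.mem_union, Finset.mem_Ioo] at hl ⊢
    omega

/-- A clique that meets both arcs misses at least 2p > p vertices, so it avoids one arc entirely.
That arc has at least `p` interior vertices by `gap`, hence these are all the missed ones. -/
theorem arc_missing {K : Set V} (hK : G.IsClique K) {i : ℕ} (hi : 0 < i) (hic : i < c)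
    (h0i : Opposed G S c p (a 0) (a i)) (hp : 1 ≤ p) (hM : (missing a c K).card ≤ p) :
    (∀ l < c, l ∈ missing a c K ↔ 0 < l ∧ l < i) ∧ i = p + 1 ∨
    (∀ l < c, l ∈ missing a c K ↔ i < l ∧ l < c) ∧ c = i + p + 1 := by
  have hg := ha.gap hi hic h0i
  have hall : (∀ s, 0 < s → s < i → a s ∉ K) ∨ (∀ t, i < t → t < c → a t ∉ K) := by
    by_contra! hcon
    obtain ⟨hA, hB⟩ := hcon
    have := (ha.two_mul_le_of_hit hK le_rfl h0i h0i hA hB).trans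
      (Finset.card_le_card Finset.inter_subset_left)
    omega
  rcases hall with h | h
  · have hsub : Finset.Ioo 0 i ⊆ missing a c K := by
      intro l hl
      rw [Finset.mem_Ioo] at hl
      exact mem_missing.2 ⟨by omega, h l hl.1 hl.2⟩
    have hle := Finset.card_le_card hsub
    have heq := Finset.eq_of_subset_of_card_le hsub (by simp only [Nat.card_Ioo] at *; omega)
    simp only [Nat.card_Ioo] at hle
    exact Or.inl ⟨fun l _ => by rw [← heq, Finset.mem_Ioo], by omega⟩
  · have hsub : Finset.Ioo i c ⊆ missing a c K := by
      intro l hl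
      rw [Finset.mem_Ioo] at hl
      exact mem_missing.2 ⟨by omega, h l hl.1 hl.2⟩
    have hle := Finset.card_le_card hsub
    have heq := Finset.eq_of_subset_of_card_le hsub (by simp only [Nat.card_Ioo] at *; omega)
    simp only [Nat.card_Ioo] at hle
    exact Or.inr ⟨fun l _ => by rw [← heq, Finset.mem_Ioo], by omega⟩

/-- Only the two arcs next to `a 0` matter, those ending at the first and at the last index of `I`.
If the clique meets both, it misses 2p vertices there and at least |I| - 2 successors elsewhere. If
it avoids one, it misses at least `p` vertices there and |I| - 1 successors or predecessors outside
that arc. Under the hypotheses of the stronger bound, that last case gains a further |I| - 1 missed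
vertices from the opposite family of neighbours along the cycle. -/
theorem add_card_le_missing_add {K : Set V} (hK : G.IsClique K) {I : Finset ℕ} (hI : I.Nonempty)
    (hIc : ∀ i ∈ I, 0 < i ∧ i < c) (hp : 1 ≤ p) (h0 : ∀ i ∈ I, Opposed G S c p (a 0) (a i))
    (h1 : ∀ i ∈ I, ∀ j ∈ I, i < j → Opposed G S c 1 (a i) (a j)) :
    p + I.card ≤ (missing a c K).card + 1 ∧
      (2 ≤ p → 2 ≤ I.card → (∀ i ∈ I, ∀ j ∈ I, i < j → Opposed G S c p (a i) (a j)) →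
        p + I.card ≤ (missing a c K).card) := by
  classical
  obtain ⟨l, hl, hmin⟩ := Finset.exists_min_image I id hI
  obtain ⟨r, hr, hmax⟩ := Finset.exists_max_image I id hI
  simp only [id] at hmin hmax
  have hlr := hmin r hr
  have hlc := hIc l hl
  have hrc := hIc r hr
  have gap0 : ∀ i ∈ I, p + 1 ≤ i ∧ p + i + 1 ≤ c := by
    intro i hi
    have := ha.gap (hIc i hi).1 (hIc i hi).2 (h0 i hi)
    omega
  have gap1 : ∀ i ∈ I, ∀ j ∈ I, i < j → i + 2 ≤ j := by
    intro i hi j hj hij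
    have := ha.gap hij (hIc j hj).2 (h1 i hi j hj hij)
    omega
  have gapl := gap0 l hl
  have gapr := gap0 r hr
  -- successors and predecessors of the listed attachments
  have hsucc : ∀ J ⊆ insert 0 I,
      J.card ≤ (J.image (· + 1) ∩ missing a c K).card + 1 := by
    intro J hJ
    rw [← Finset.card_image_of_injective J (add_left_injective 1)]
    refine ha.card_le_missing_succ hK ?_ ?_
    · intro e he
      obtain ⟨i, hi, rfl⟩ := Finset.mem_image.1 he
      rcases Finset.mem_insert.1 (hJ hi) with rfl | hi
      · show 0 + 1 < c
        omega
      · have := gap0 i hi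
        show i + 1 < c
        omega
    · intro e he f hf hef
      obtain ⟨i, hi, rfl⟩ := Finset.mem_image.1 he
      obtain ⟨j, hj, rfl⟩ := Finset.mem_image.1 hf
      have hij : i < j := by simpa using hef
      rcases Finset.mem_insert.1 (hJ hj) with rfl | hj
      · omega
      have hj' := gap0 j hj
      refine ha.not_adj_succ hij (by omega) ?_
      rcases Finset.mem_insert.1 (hJ hi) with rfl | hi
      · exact (h0 j hj).mono hp
      · exact h1 i hi j hj hij
  -- Here `c` stands for the index 0, so that subtracting 1 gives the cyclic predecessor `c - 1`.
  have hpred : ∀ J ⊆ insert c I,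
      J.card ≤ (J.image (· - 1) ∩ missing a c K).card + 1 := by
    intro J hJ
    have hpos : ∀ i ∈ J, 1 ≤ i := by
      intro i hi
      rcases Finset.mem_insert.1 (hJ hi) with rfl | hi
      · omega
      · have := gap0 i hi
        omega
    rw [← Finset.card_image_of_injOn (f := (· - 1)) (s := J) (by
      intro i hi j hj hij
      have h1 := hpos i hi
      have h2 := hpos j hj
      simp only at hij
      omega)]
    refine ha.card_le_missing_succ hK ?_ ?_
    · intro e he
      obtain ⟨i, hi, rfl⟩ := Finset.mem_image.1 he
      have hi1 := hpos i hi
      rcases Finset.mem_insert.1 (hJ hi) with rfl | hi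
      · show i - 1 < i
        omega
      · have := gap0 i hi
        show i - 1 < c
        omega
    · intro e he f hf hef
      obtain ⟨i, hi, rfl⟩ := Finset.mem_image.1 he
      obtain ⟨j, hj, rfl⟩ := Finset.mem_image.1 hf
      have hij : i < j := by omega
      rcases Finset.mem_insert.1 (hJ hi) with rfl | hi
      · rcases Finset.mem_insert.1 (hJ hj) with rfl | hj
        · omega
        · have := gap0 j hj
          omega
      have hi' := gap0 i hi
      rcases Finset.mem_insert.1 (hJ hj) with rfl | hj
      · exact ha.not_adj_pred_zero (by omega) (by omega) ((h0 i hi).mono hp)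
      · exact ha.not_adj_pred (by omega) hij (hIc j hj).2 (h1 i hi j hj hij)
  have hcount : ∀ X Y : Finset ℕ, X ⊆ missing a c K → Y ⊆ missing a c K → Disjoint X Y →
      X.card + Y.card ≤ (missing a c K).card := by
    intro X Y hX hY hXY
    rw [← Finset.card_union_of_disjoint hXY]
    exact Finset.card_le_card (Finset.union_subset hX hY)
  have hcount3 : ∀ X Y Z : Finset ℕ, X ⊆ missing a c K → Y ⊆ missing a c K → Z ⊆ missing a c K →
      Disjoint X Y → Disjoint X Z → Disjoint Y Z →
      X.card + Y.card + Z.card ≤ (missing a c K).card := by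
    intro X Y Z hX hY hZ hXY hXZ hYZ
    rw [← Finset.card_union_of_disjoint hXY]
    exact hcount _ _ (Finset.union_subset hX hY) hZ (Finset.disjoint_union_left.2 ⟨hXZ, hYZ⟩)
  have hIi : I ⊆ insert 0 I := Finset.subset_insert _ _
  have hIci : I ⊆ insert c I := Finset.subset_insert _ _
  have h0I : (0 : ℕ) ∉ I := fun h => by have := hIc 0 h; omega
  have hcI : c ∉ I := fun h => by have := hIc c h; omega
  by_cases hA : ∃ s, 0 < s ∧ s < l ∧ a s ∈ K
  · by_cases hB : ∃ t, r < t ∧ t < c ∧ a t ∈ K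
    · have e1 := ha.two_mul_le_of_hit hK hlr (h0 l hl) (h0 r hr) hA hB
      have e2 := hsucc (I.erase r) ((Finset.erase_subset _ _).trans hIi)
      rw [Finset.card_erase_of_mem hr] at e2
      have e3 := hcount _ _ (Finset.inter_subset_left (s₁ := missing a c K)
        (s₂ := Finset.Ioo 0 l ∪ Finset.Ioo r c))
        (Finset.inter_subset_right (s₁ := (I.erase r).image (· + 1))) (by
          rw [Finset.disjoint_left]
          intro x hx hx'
          obtain ⟨i, hi, rfl⟩ := Finset.mem_image.1 (Finset.mem_inter.1 hx').1
          have hi' := Finset.mem_erase.1 hi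
          have g1 := hmin i hi'.2
          have g2 := hmax i hi'.2
          have g3 := hi'.1
          have := (Finset.mem_inter.1 hx).2
          simp only [Finset.mem_union, Finset.mem_Ioo] at this
          omega)
      have := hI.card_pos
      constructor
      · omega
      · intros
        omega
    · have hX : Finset.Ioo r c ⊆ missing a c K := by
        intro x hx
        rw [Finset.mem_Ioo] at hx
        exact mem_missing.2 ⟨hx.2, fun h => hB ⟨x, hx.1, hx.2, h⟩⟩
      have hXc : p ≤ (Finset.Ioo r c).card := by
        rw [Nat.card_Ioo]
        omega
      have hY := hpred I hIci
      have hXY : Disjoint (Finset.Ioo r c) (I.image (· - 1) ∩ missing a c K) := by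
        rw [Finset.disjoint_left]
        intro x hx hx'
        obtain ⟨i, hi, rfl⟩ := Finset.mem_image.1 (Finset.mem_inter.1 hx').1
        have := hmax i hi
        simp only [Finset.mem_Ioo] at hx
        omega
      constructor
      · have := hcount _ _ hX Finset.inter_subset_right hXY
        omega
      · intro hp2 hI2 hIp
        -- Gaps of at least 3, available because p ≥ 2, keep the successor of one attachment
        -- distinct from the predecessor of the next.
        have gapp : ∀ i ∈ I, ∀ j ∈ I, i < j → i + 3 ≤ j := by
          intro i hi j hj hij
          have := ha.gap hij (hIc j hj).2 (hIp i hi j hj hij)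
          omega
        have hZ := hsucc (insert 0 (I.erase r)) (Finset.insert_subset_insert _
          (Finset.erase_subset _ _))
        rw [Finset.card_insert_of_notMem (fun h => h0I (Finset.mem_of_mem_erase h)),
          Finset.card_erase_of_mem hr] at hZ
        have hi_cases : ∀ i ∈ insert 0 (I.erase r), i = 0 ∨ (i ∈ I ∧ i < r) := by
          intro i hi
          rcases Finset.mem_insert.1 hi with h | h
          · exact Or.inl h
          · have := Finset.mem_erase.1 h
            have h' := hmax i this.2
            exact Or.inr ⟨this.2, by omega⟩
        have := hcount3 _ _ ((insert 0 (I.erase r)).image (· + 1) ∩ missing a c K) hX Finset.inter_subset_right Finset.inter_subset_right hXY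
          (by
            rw [Finset.disjoint_left]
            intro x hx hx'
            obtain ⟨i, hi, rfl⟩ := Finset.mem_image.1 (Finset.mem_inter.1 hx').1
            simp only [Finset.mem_Ioo] at hx
            rcases hi_cases i hi with h | h <;> omega) (by
            rw [Finset.disjoint_left]
            intro x hx hx'
            obtain ⟨i, hi, rfl⟩ := Finset.mem_image.1 (Finset.mem_inter.1 hx).1
            obtain ⟨j, hj, hij⟩ := Finset.mem_image.1 (Finset.mem_inter.1 hx').1
            have hi' := gap0 i hi
            rcases hi_cases j hj with h | h
            · omega
            · have := gapp j h.1 i hi (by omega)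
              omega)
        omega
  · have hX : Finset.Ioo 0 l ⊆ missing a c K := by
      intro x hx
      rw [Finset.mem_Ioo] at hx
      exact mem_missing.2 ⟨by omega, fun h => hA ⟨x, hx.1, hx.2, h⟩⟩
    have hXc : p ≤ (Finset.Ioo 0 l).card := by
      rw [Nat.card_Ioo]
      omega
    have hY := hsucc I hIi
    have hXY : Disjoint (Finset.Ioo 0 l) (I.image (· + 1) ∩ missing a c K) := by
      rw [Finset.disjoint_left]
      intro x hx hx'
      obtain ⟨i, hi, rfl⟩ := Finset.mem_image.1 (Finset.mem_inter.1 hx').1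
      have := hmin i hi
      simp only [Finset.mem_Ioo] at hx
      omega
    constructor
    · have := hcount _ _ hX Finset.inter_subset_right hXY
      omega
    · intro hp2 hI2 hIp
      have gapp : ∀ i ∈ I, ∀ j ∈ I, i < j → i + 3 ≤ j := by
        intro i hi j hj hij
        have := ha.gap hij (hIc j hj).2 (hIp i hi j hj hij)
        omega
      have hZ := hpred (insert c (I.erase l)) (Finset.insert_subset_insert _
        (Finset.erase_subset _ _))
      rw [Finset.card_insert_of_notMem (fun h => hcI (Finset.mem_of_mem_erase h)),
        Finset.card_erase_of_mem hl] at hZ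
      have hi_cases : ∀ i ∈ insert c (I.erase l), i = c ∨ (i ∈ I ∧ l < i) := by
        intro i hi
        rcases Finset.mem_insert.1 hi with h | h
        · exact Or.inl h
        · have := Finset.mem_erase.1 h
          have h' := hmin i this.2
          exact Or.inr ⟨this.2, by omega⟩
      have := hcount3 _ _ ((insert c (I.erase l)).image (· - 1) ∩ missing a c K) hX Finset.inter_subset_right Finset.inter_subset_right hXY
        (by
          rw [Finset.disjoint_left]
          intro x hx hx'
          obtain ⟨i, hi, rfl⟩ := Finset.mem_image.1 (Finset.mem_inter.1 hx').1
          simp only [Finset.mem_Ioo] at hx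
          rcases hi_cases i hi with h | h <;> omega) (by
          rw [Finset.disjoint_left]
          intro x hx hx'
          obtain ⟨i, hi, rfl⟩ := Finset.mem_image.1 (Finset.mem_inter.1 hx).1
          obtain ⟨j, hj, hij⟩ := Finset.mem_image.1 (Finset.mem_inter.1 hx').1
          have hi' := gap0 i hi
          rcases hi_cases j hj with h | h
          · omega
          · have := gapp i hi j h.1 (by omega)
            omega)
      omega

end IsCyclicListing

/-! ### Components, linkage and Hamiltonian paths of cliques -/

open scoped Classical

/-- The induced subgraph on `A` is connected: no proper nonempty part is separated from the rest. -/
def ConnOn (G : SimpleGraph V) (A : Finset V) : Prop :=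
  ∀ B ⊆ A, B.Nonempty → B ≠ A → ∃ v ∈ B, ∃ w ∈ A, w ∉ B ∧ G.Adj v w

/-- Every nonempty part of `A` has at least two neighbours in `S` outside that part. -/
def TwoLinked (G : SimpleGraph V) (A : Finset V) (S : Set V) : Prop :=
  ∀ B ⊆ A, B.Nonempty → ∀ z, ∃ v ∈ B, ∃ w ∈ S, w ∉ B ∧ w ≠ z ∧ G.Adj v w

/-- Every vertex lies in a component of a given finite vertex set. -/
theorem exists_component (S : Finset V) {x : V} (hx : x ∈ S) :
    ∃ H ⊆ S, x ∈ H ∧ ConnOn G H ∧ ∀ v ∈ H, ∀ w ∈ S, G.Adj v w → w ∈ H := by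
  obtain ⟨H, hH, hmin⟩ := Finset.exists_min_image
    (S.powerset.filter (fun H => x ∈ H ∧ ∀ v ∈ H, ∀ w ∈ S, G.Adj v w → w ∈ H)) Finset.card
    ⟨S, by simp only [Finset.mem_filter, Finset.mem_powerset]; exact ⟨subset_rfl, hx, by tauto⟩⟩
  simp only [Finset.mem_filter, Finset.mem_powerset, and_imp] at hH hmin
  obtain ⟨hHS, hxH, hcl⟩ := hH
  refine ⟨H, hHS, hxH, ?_, hcl⟩
  intro B hB hBn hBH
  by_contra! hno
  have hss : B ⊂ H := lt_of_le_of_ne hB hBH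
  have hclB : ∀ v ∈ B, ∀ w ∈ S, G.Adj v w → w ∈ B := by
    intro v hv w hw hvw
    by_contra hwB
    exact hno v hv w (hcl v (hB hv) w hw hvw) hwB hvw
  by_cases hxB : x ∈ B
  · have := hmin B (hB.trans hHS) hxB hclB
    have := Finset.card_lt_card hss
    omega
  · have := hmin (H \ B) (Finset.sdiff_subset.trans hHS) (by simp [hxH, hxB]) (by
      intro v hv w hw hvw
      rw [Finset.mem_sdiff] at hv ⊢
      refine ⟨hcl v hv.1 w hw hvw, fun hwB => hv.2 ?_⟩
      exact hclB w hwB v (hHS hv.1) hvw.symm)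
    have h1 := Finset.card_sdiff_add_card_eq_card hB
    have := hBn.card_pos
    omega

theorem exists_pathIn_of_connOn {A : Finset V} (hA : ConnOn G A) {x y : V}
    (hx : x ∈ A) (hy : y ∈ A) : ∃ m, PathIn G A x y m := by
  by_contra hno
  set R := A.filter (fun z => ∃ m, PathIn G A x z m) with hR
  have hxR : x ∈ R := by simp [hR, hx]; exact ⟨0, .single (by simpa using hx)⟩
  obtain ⟨v, hv, w, hw, hwR, hvw⟩ := hA R (Finset.filter_subset _ _) ⟨x, hxR⟩ (by
    intro h
    rw [← h, hR, Finset.mem_filter] at hy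
    exact hno hy.2)
  apply hwR
  rw [hR, Finset.mem_filter] at hv ⊢
  obtain ⟨-, m, p, hp, hpl, hps⟩ := hv
  refine ⟨hw, (p.concat hvw).bypass.length, (p.concat hvw).bypass, Walk.bypass_isPath _, rfl, ?_⟩
  intro u hu
  have := Walk.support_bypass_subset_support _ hu
  rw [Walk.support_concat, List.mem_append, List.mem_singleton] at this
  rcases this with h | rfl
  · exact hps u h
  · exact hw

/-- A clique has a Hamiltonian path between any two of its vertices. -/
theorem pathIn_of_isClique {A : Finset V} (hA : G.IsClique A) {f t : V}
    (hf : f ∈ A) (ht : t ∈ A) (hft : f ≠ t) : PathIn G A f t (A.card - 1) := by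
  induction hn : A.card generalizing A f with
  | zero => simp_all
  | succ n ih =>
    have hE : (A.erase f).card = n := by rw [Finset.card_erase_of_mem hf, hn]; rfl
    have htE : t ∈ A.erase f := Finset.mem_erase.2 ⟨hft.symm, ht⟩
    by_cases hs : ∃ s ∈ A.erase f, s ≠ t
    · obtain ⟨s, hs, hst⟩ := hs
      have h := ih (hA.subset (by simp)) hs htE hst hE
      have hsA := Finset.mem_erase.1 hs
      have h' := h.cons (hA hf hsA.2 hsA.1.symm) (by simp)
      have hn1 : 1 ≤ n := hE ▸ Finset.card_pos.2 ⟨t, htE⟩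
      rw [show n + 1 - 1 = n - 1 + 1 by omega]
      exact h'.mono (by intro v hv; simp at hv; rcases hv with rfl | hv; exacts [hf, hv])
    · push Not at hs
      have : A.erase f = {t} := by
        ext s
        exact ⟨fun h => by simpa using hs s h, fun h => by simp at h; exact h ▸ htE⟩
      rw [this] at hE
      simp at hE
      subst hE
      exact PathIn.edge (hA hf ht hft) hf ht

/-- A clique has a Hamiltonian path ending at any given vertex. -/
theorem exists_pathIn_of_isClique {A : Finset V} (hA : G.IsClique A) {t : V}
    (ht : t ∈ A) : ∃ f ∈ A, PathIn G A f t (A.card - 1) := by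
  by_cases hs : ∃ s ∈ A, s ≠ t
  · obtain ⟨s, hs, hst⟩ := hs
    exact ⟨s, hs, pathIn_of_isClique hA hs ht hst⟩
  · push Not at hs
    have : A = {t} := by
      ext s
      exact ⟨fun h => by simpa using hs s h, fun h => by simp at h; exact h ▸ ht⟩
    subst this
    exact ⟨t, by simp, by simpa using PathIn.single (G := G) (Set.mem_singleton t)⟩

theorem PathIn.trans {S T : Set V} {x y z : V} {m l : ℕ} (h₁ : PathIn G S x y m)
    (h₂ : PathIn G T y z l) (hd : ∀ v ∈ S, v ∈ T → v = y) : PathIn G (S ∪ T) x z (m + l) := by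
  obtain ⟨p, hp, hpl, hps⟩ := h₁
  obtain ⟨q, hq, hql, hqs⟩ := h₂
  have hqn := hq.support_nodup
  rw [← Walk.cons_tail_support, List.nodup_cons] at hqn
  refine ⟨p.append q, ?_, by simp [hpl, hql], ?_⟩
  · rw [Walk.isPath_def, Walk.support_append, List.nodup_append]
    refine ⟨hp.support_nodup, hqn.2, ?_⟩
    rintro a ha b hb rfl
    have := hd a (hps a ha) (hqs a (List.mem_of_mem_tail hb))
    exact hqn.1 (this ▸ hb)
  · intro v hv
    rw [Walk.mem_support_append_iff] at hv
    exact hv.imp (hps v) (hqs v)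

/-! ### Long paths from degree conditions -/

/-- The number of neighbours of `v` in `S`. -/
noncomputable def degIn (G : SimpleGraph V) (S : Finset V) (v : V) : ℕ :=
  (S.filter (G.Adj v)).card

theorem degIn_le_card {S T : Finset V} {v : V} (h : ∀ w ∈ S, G.Adj v w → w ∈ T) :
    degIn G S v ≤ T.card :=
  Finset.card_le_card fun w hw => by
    rw [Finset.mem_filter] at hw
    exact h w hw.1 hw.2

theorem degIn_le_add {S T U : Finset V} {v : V} (h : ∀ w ∈ S, G.Adj v w → w ∈ T ∨ w ∈ U) :
    degIn G S v ≤ degIn G T v + degIn G U v := by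
  refine le_trans (Finset.card_le_card ?_) (Finset.card_union_le _ _)
  intro w hw
  rw [Finset.mem_filter] at hw
  simp only [Finset.mem_union, Finset.mem_filter]
  exact (h w hw.1 hw.2).imp (fun h => ⟨h, hw.2⟩) (fun h => ⟨h, hw.2⟩)

theorem adj_of_card_le_degIn {S T : Finset V} {v : V} (h : ∀ w ∈ S, G.Adj v w → w ∈ T)
    (hT : T.card ≤ degIn G S v) : ∀ w ∈ T, G.Adj v w := by
  have hsub : S.filter (G.Adj v) ⊆ T := fun w hw => by
    rw [Finset.mem_filter] at hw
    exact h w hw.1 hw.2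
  have := Finset.eq_of_subset_of_card_le hsub hT
  intro w hw
  rw [← this, Finset.mem_filter] at hw
  exact hw.2

/-- A path version of the Erdős–Gallai theorem, with a description of the extremal case: if the
vertices of the connected set `A` have degree at least `k` in the 2-connected system `A ∪ {x, y}`
and `A` has at least `k` vertices, then there is an `x`-`y`-path of length at least `k + 1`. -/
theorem card_lt_or_exists_pathIn (n : ℕ) : ∀ (A : Finset V) (x y : V) (k : ℕ), A.card ≤ n →
    x ∉ A → y ∉ A → x ≠ y → A.Nonempty → ConnOn G A →
    TwoLinked G A (insert x (insert y A) : Finset V) →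
    (∀ v ∈ A, k ≤ degIn G (insert x (insert y A)) v) →
    A.card + 1 ≤ k ∨ ∃ m, k + 1 ≤ m ∧ PathIn G (insert x (insert y A) : Finset V) x y m := by
  induction n with
  | zero =>
    intro A x y k hA _ _ _ hne
    have := hne.card_pos
    omega
  | succ n ih =>
  intro A x y k hAn hxA hyA hxy hAne hconn h2 hdeg
  by_contra! hcon
  obtain ⟨hkA, hno⟩ := hcon
  -- a smallest part of `A` cut off by `x` and one more vertex
  let Q : Finset V → V → Prop := fun B b => B ⊆ A ∧ B.Nonempty ∧ b ∈ insert y A ∧ b ∉ B ∧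
    ∀ v ∈ B, ∀ w ∈ insert x (insert y A), G.Adj v w → w ∈ B ∨ w = x ∨ w = b
  have hex : ∃ m, ∃ B b, Q B b ∧ B.card = m := by
    refine ⟨_, A, y, ⟨subset_rfl, hAne, by simp, hyA, ?_⟩, rfl⟩
    intro v _ w hw _
    simp only [Finset.mem_insert] at hw
    tauto
  obtain ⟨B, b, ⟨hBA, hBne, hbA, hbB, hBN⟩, hBcard⟩ := Nat.find_spec hex
  have hmin : ∀ B' b', Q B' b' → B.card ≤ B'.card := by
    intro B' b' h
    rw [hBcard]
    exact Nat.find_min' hex ⟨B', b', h, rfl⟩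
  have hxB : x ∉ B := fun h => hxA (hBA h)
  have hbx : b ≠ x := by
    rintro rfl
    rcases Finset.mem_insert.1 hbA with h | h
    · exact hxy h
    · exact hxA h
  -- from `b` on to `y`
  have hsuf : ∃ l, PathIn G (insert y A \ B : Finset V) b y l := by
    obtain ⟨R, hRT, hbR, hRconn, hRcl⟩ := exists_component (G := G) (insert y A \ B)
      (x := b) (by simp only [Finset.mem_sdiff]; exact ⟨hbA, hbB⟩)
    by_cases hyR : y ∈ R
    · obtain ⟨l, hl⟩ := exists_pathIn_of_connOn hRconn hbR hyR
      exact ⟨l, hl.mono (by exact_mod_cast hRT)⟩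
    · exfalso
      have hRA : R ⊆ A := by
        intro v hv
        have := hRT hv
        simp only [Finset.mem_sdiff, Finset.mem_insert] at this
        rcases this.1 with rfl | h
        · exact absurd hv hyR
        · exact h
      obtain ⟨v, hv, w, hw, hwBR, hwx, hvw⟩ := h2 (B ∪ R) (Finset.union_subset hBA hRA)
        (hBne.mono Finset.subset_union_left) x
      rw [Finset.mem_union, not_or] at hwBR
      rcases Finset.mem_union.1 hv with hv | hv
      · rcases hBN v hv w (by exact_mod_cast hw) hvw with h | h | h
        · exact hwBR.1 h
        · exact hwx h
        · exact hwBR.2 (h ▸ hbR)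
      · refine hwBR.2 (hRcl v hv w ?_ hvw)
        rw [Finset.mem_sdiff]
        refine ⟨?_, hwBR.1⟩
        have hw' : w ∈ insert x (insert y A) := by exact_mod_cast hw
        exact (Finset.mem_insert.1 hw').resolve_left hwx
  obtain ⟨l, hl⟩ := hsuf
  have hsubB : (B : Set V) ⊆ (insert x (insert y A) : Finset V) := by
    intro v hv
    have := hBA (by exact_mod_cast hv)
    simp [this]
  have hsubl : ((insert y A \ B : Finset V) : Set V) ⊆ (insert x (insert y A) : Finset V) := by
    intro v hv
    simp only [Finset.coe_sdiff, Set.mem_sdiff, Finset.mem_coe] at hv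
    simp only [Finset.mem_coe]
    exact Finset.mem_insert_of_mem hv.1
  -- no long path in `B` can be extended
  have hshort : ∀ x' ∈ B, G.Adj x x' → ∀ m, PathIn G (insert b B : Finset V) x' b m → m < k := by
    intro x' hx' hxx' m hm
    by_contra hkm
    have h1 := hm.cons hxx' (by simp [hxB, hbx.symm])
    have h3 := h1.trans hl (by
      intro v hv hv'
      simp only [Finset.coe_insert, Finset.coe_sdiff, Set.mem_insert_iff, Set.mem_sdiff,
        Finset.mem_coe] at hv hv'
      rcases hv with rfl | rfl | hv
      · rcases hv'.1 with h | h
        · exact absurd h hxy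
        · exact absurd h hxA
      · rfl
      · exact absurd hv hv'.2)
    have h2' := hno (m + 1 + l) (by omega)
    refine h2' (h3.mono (Set.union_subset (Set.insert_subset (by simp) ?_) hsubl))
    rw [Finset.coe_insert]
    refine Set.insert_subset ?_ hsubB
    simp only [Finset.mem_coe]
    exact Finset.mem_insert_of_mem hbA
  -- If |B| < k, the degrees leave no slack: `B` is a clique completely joined to `x` and `b`. For b
  -- = y, connectedness gives B = A, which is too small. Otherwise a Hamiltonian path of `B`,
  -- preceded by `x` and continued through `b` to `y`, is long enough.
  have hkB : k ≤ B.card := by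
    by_contra hlt
    have hall : ∀ v ∈ B, ∀ w ∈ (B.erase v) ∪ {x, b}, G.Adj v w := by
      intro v hv
      refine adj_of_card_le_degIn (S := insert x (insert y A)) ?_ ?_
      · intro w hw hvw
        simp only [Finset.mem_union, Finset.mem_erase, Finset.mem_insert, Finset.mem_singleton]
        rcases hBN v hv w hw hvw with h | h | h
        · exact Or.inl ⟨hvw.ne', h⟩
        · exact Or.inr (Or.inl h)
        · exact Or.inr (Or.inr h)
      · refine (Finset.card_union_le _ _).trans ?_
        have h1 := hdeg v (hBA hv)
        have h2 : ({x, b} : Finset V).card ≤ 2 := Finset.card_le_two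
        have h3 := Finset.card_erase_of_mem hv
        have h4 := hBne.card_pos
        omega
    by_cases hby : b = y
    · have hBA' : B = A := by
        by_contra hne
        obtain ⟨v, hv, w, hw, hwB, hvw⟩ := hconn B hBA hBne hne
        rcases hBN v hv w (by simp [hw]) hvw with h | h | h
        · exact hwB h
        · exact hxA (h ▸ hw)
        · exact hyA (hby ▸ h ▸ hw)
      rw [hBA'] at hlt
      omega
    · have hBclique : G.IsClique B := by
        intro v hv w hw hvw
        exact hall v hv w (by
          simp only [Finset.mem_union, Finset.mem_erase]
          exact Or.inl ⟨hvw.symm, hw⟩)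
      obtain ⟨t, ht⟩ := hBne
      obtain ⟨f, hf, hP⟩ := exists_pathIn_of_isClique hBclique ht
      have h1 := hP.cons (hall f hf x (by simp)).symm (by simpa using hxB)
      have h3 := h1.link (hall t ht b (by simp)) hl (by
        intro v hv hv'
        simp only [Finset.coe_insert, Finset.coe_sdiff, Set.mem_insert_iff, Set.mem_sdiff,
          Finset.mem_coe] at hv hv'
        rcases hv with rfl | hv
        · rcases hv'.1 with h | h
          · exact absurd h hxy
          · exact absurd h hxA
        · exact absurd hv hv'.2)
      have hl1 := hl.pos hby
      have h1' := hdeg t (hBA ht)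
      have h2' := degIn_le_card (G := G) (S := insert x (insert y A)) (v := t)
        (T := (B.erase t) ∪ {x, b}) (by
          intro w hw hvw
          simp only [Finset.mem_union, Finset.mem_erase, Finset.mem_insert, Finset.mem_singleton]
          rcases hBN t ht w hw hvw with h | h | h
          · exact Or.inl ⟨hvw.ne', h⟩
          · exact Or.inr (Or.inl h)
          · exact Or.inr (Or.inr h))
      have h3' := Finset.card_union_le (B.erase t) {x, b}
      have h4' : ({x, b} : Finset V).card ≤ 2 := Finset.card_le_two
      have h5' := Finset.card_erase_of_mem ht
      have h6' := Finset.card_pos.2 ⟨t, ht⟩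
      refine hno _ ?_ (h3.mono (Set.union_subset (Set.insert_subset (by simp) hsubB) hsubl))
      omega
  -- components after the deletion of a neighbour of `x`
  have hcomp : ∀ x' ∈ B, G.Adj x x' → ∀ A' ⊆ B.erase x', A'.Nonempty → ConnOn G A' →
      (∀ v ∈ A', ∀ w ∈ B.erase x', G.Adj v w → w ∈ A') →
      A'.card + 2 ≤ k ∧ ∀ v ∈ A', G.Adj v x ∧ G.Adj v x' ∧ A'.card + 2 = k := by
    intro x' hx' hxx' A' hA'B hA'ne hA'conn hA'cl
    have hx'A' : x' ∉ A' := fun h => by simpa using hA'B h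
    have hA'sub : A' ⊆ B := hA'B.trans (Finset.erase_subset _ _)
    have hbA' : b ∉ A' := fun h => hbB (hA'sub h)
    have hx'b : x' ≠ b := fun h => hbB (h ▸ hx')
    have hA'lt : A'.card < B.card :=
      Finset.card_lt_card ⟨hA'sub, fun h => hx'A' (h hx')⟩
    have hnb : ∀ v ∈ A', ∀ w ∈ insert x (insert y A), G.Adj v w →
        w ∈ A' ∨ w = x' ∨ w = b ∨ w = x := by
      intro v hv w hw hvw
      rcases hBN v (hA'sub hv) w hw hvw with h | h | h
      · by_cases hwx' : w = x'
        · exact Or.inr (Or.inl hwx')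
        · exact Or.inl (hA'cl v hv w (Finset.mem_erase.2 ⟨hwx', h⟩) hvw)
      · exact Or.inr (Or.inr (Or.inr h))
      · exact Or.inr (Or.inr (Or.inl h))
    have hBcardn : B.card ≤ A.card := Finset.card_le_card hBA
    have hcard : A'.card + 1 ≤ k - 1 := by
      refine (ih A' x' b (k - 1) (by omega) hx'A' hbA' hx'b hA'ne hA'conn ?_ ?_).resolve_right ?_
      · intro B' hB' hB'ne z
        by_contra! hnone
        have hB'B : B' ⊆ B := hB'.trans hA'sub
        have hlt : B'.card < B.card := (Finset.card_le_card hB').trans_lt hA'lt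
        have hbad : ∀ v ∈ B', ∀ w ∈ insert x (insert y A), G.Adj v w →
            w ∈ B' ∨ w = x ∨ w = z := by
          intro v hv w hw hvw
          by_contra! hw'
          rcases hnb v (hB' hv) w hw hvw with h | h | h | h
          · exact hnone v hv w (by simp [h]) hw'.1 hw'.2.2 hvw
          · exact hnone v hv w (by simp [h]) hw'.1 hw'.2.2 hvw
          · exact hnone v hv w (by simp [h]) hw'.1 hw'.2.2 hvw
          · exact hw'.2.1 h
        by_cases hz : z ∈ insert b B \ B'
        · rw [Finset.mem_sdiff, Finset.mem_insert] at hz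
          have := hmin B' z ⟨hB'B.trans hBA, hB'ne, by
            rcases hz.1 with rfl | h
            · exact hbA
            · exact Finset.mem_insert_of_mem (hBA h), hz.2, hbad⟩
          omega
        · have := hmin B' b ⟨hB'B.trans hBA, hB'ne, hbA, fun h => hbB (hB'B h), by
            intro v hv w hw hvw
            rcases hbad v hv w hw hvw with h | h | h
            · exact Or.inl h
            · exact Or.inr (Or.inl h)
            · by_contra hcc
              rcases hBN v (hB'B hv) w hw hvw with h' | h' | h'
              · refine hz ?_
                rw [← h, Finset.mem_sdiff]
                exact ⟨Finset.mem_insert_of_mem h', fun h'' => hcc (Or.inl h'')⟩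
              · exact hcc (Or.inr (Or.inl h'))
              · exact hcc (Or.inr (Or.inr h'))⟩
          omega
      · intro v hv
        have h1 := hdeg v (hBA (hA'sub hv))
        have h2 := degIn_le_add (G := G) (S := insert x (insert y A))
          (T := insert x' (insert b A')) (U := {x}) (v := v) (by
            intro w hw hvw
            simp only [Finset.mem_insert, Finset.mem_singleton]
            rcases hnb v hv w hw hvw with h | h | h | h <;> tauto)
        have h3 : degIn G {x} v ≤ 1 := degIn_le_card (T := {x}) (fun w hw _ => hw)
        omega
      · rintro ⟨m, hm, hP⟩
        have := hshort x' hx' hxx' m (hP.mono (by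
          intro v hv
          simp only [Finset.coe_insert, Set.mem_insert_iff, Finset.mem_coe] at hv ⊢
          rcases hv with rfl | h | h
          · exact Or.inr hx'
          · exact Or.inl h
          · exact Or.inr (hA'sub h)))
        omega
    refine ⟨by omega, ?_⟩
    intro v hv
    have hT : ((A'.erase v) ∪ {x, x', b}).card ≤ A'.card + 2 := by
      refine (Finset.card_union_le _ _).trans ?_
      have h3 : ({x, x', b} : Finset V).card ≤ 3 := Finset.card_le_three
      have h4 := Finset.card_erase_of_mem hv
      have h5 := hA'ne.card_pos
      omega
    have hsub : ∀ w ∈ insert x (insert y A), G.Adj v w → w ∈ (A'.erase v) ∪ {x, x', b} := by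
      intro w hw hvw
      simp only [Finset.mem_union, Finset.mem_erase, Finset.mem_insert, Finset.mem_singleton]
      rcases hnb v hv w hw hvw with h | h | h | h
      · exact Or.inl ⟨hvw.ne', h⟩
      all_goals tauto
    have hd := hdeg v (hBA (hA'sub hv))
    have hd' := degIn_le_card hsub
    have hall := adj_of_card_le_degIn hsub (by omega)
    exact ⟨hall x (by simp), hall x' (by simp), by omega⟩
  obtain ⟨x', hx', w, hw, hwB, hwb, hx'w⟩ := h2 B hBA hBne b
  obtain rfl : w = x := by
    rcases hBN x' hx' w (by exact_mod_cast hw) hx'w with h | h | h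
    · exact absurd h hwB
    · exact h
    · exact absurd h hwb
  rcases (B.erase x').eq_empty_or_nonempty with hemp | ⟨z, hz⟩
  · have hB1 : B = {x'} := by
      rw [Finset.erase_eq_empty_iff] at hemp
      rcases hemp with h | h
      · exact absurd h hBne.ne_empty
      · exact h
    obtain ⟨u, hu, w', hw', hw'B, hw'x, huw'⟩ := h2 B hBA hBne w
    have hw'b : w' = b := by
      rcases hBN u hu w' (by exact_mod_cast hw') huw' with h | h | h
      · exact absurd h hw'B
      · exact absurd h hw'x
      · exact h
    have hux' : u = x' := by rw [hB1] at hu; simpa using hu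
    have := hshort x' hx' hx'w.symm 1 (PathIn.edge (by rw [← hw'b, ← hux']; exact huw')
      (by simp [hx']) (by simp))
    rw [hB1, Finset.card_singleton] at hkB
    omega
  -- Every component of `B` minus `x'` has exactly k - 2 vertices, so |B| ≥ k leaves room for a
  -- second one, `A₂`. Deleting `z` from `A₁` instead of `x'`, which is allowed since `z` is also
  -- adjacent to `x`, puts `x'` and all of `A₂` into one component with at least k - 1 vertices, too
  -- many.
  · obtain ⟨A₁, hA₁B, hzA₁, hA₁conn, hA₁cl⟩ := exists_component (G := G) (B.erase x') hz
    obtain ⟨h₁, h₁'⟩ := hcomp x' hx' hx'w.symm A₁ hA₁B ⟨z, hzA₁⟩ hA₁conn hA₁cl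
    have hne : ¬ B.erase x' ⊆ A₁ := by
      intro hsub
      have h3 := Finset.card_le_card hsub
      rw [Finset.card_erase_of_mem hx'] at h3
      omega
    obtain ⟨z₂, hz₂, hz₂A₁⟩ := Finset.not_subset.1 hne
    obtain ⟨A₂, hA₂B, hzA₂, hA₂conn, hA₂cl⟩ := exists_component (G := G) (B.erase x') hz₂
    obtain ⟨-, h₂'⟩ := hcomp x' hx' hx'w.symm A₂ hA₂B ⟨z₂, hzA₂⟩ hA₂conn hA₂cl
    have hzB := Finset.mem_erase.1 hz
    have hx'z : x' ∈ B.erase z := Finset.mem_erase.2 ⟨hzB.1.symm, hx'⟩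
    obtain ⟨A₃, hA₃B, hx'A₃, hA₃conn, hA₃cl⟩ := exists_component (G := G) (B.erase z) hx'z
    obtain ⟨h₃, -⟩ := hcomp z hzB.2 (h₁' z hzA₁).1.symm A₃ hA₃B ⟨x', hx'A₃⟩ hA₃conn hA₃cl
    have hzA₂' : z ∉ A₂ := by
      intro h
      -- `z` and `z₂` would lie in the same component
      have hsub : A₂ ⊆ A₁ := by
        by_contra hns
        obtain ⟨v, hv, u, hu, huI, hvu⟩ := hA₂conn (A₂ ∩ A₁) Finset.inter_subset_left
          ⟨z, Finset.mem_inter.2 ⟨h, hzA₁⟩⟩ (fun he => hns (by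
            rw [← he]; exact Finset.inter_subset_right))
        rw [Finset.mem_inter] at hv huI
        exact huI ⟨hu, hA₁cl v hv.2 u (hA₂B hu) hvu⟩
      exact hz₂A₁ (hsub hzA₂)
    have hsub : insert x' A₂ ⊆ A₃ := by
      intro v hv
      rcases Finset.mem_insert.1 hv with rfl | hv
      · exact hx'A₃
      · refine hA₃cl x' hx'A₃ v (Finset.mem_erase.2 ⟨?_, ?_⟩) (h₂' v hv).2.1.symm
        · rintro rfl
          exact hzA₂' hv
        · exact (Finset.mem_erase.1 (hA₂B hv)).2
    have hc := Finset.card_le_card hsub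
    rw [Finset.card_insert_of_notMem (fun h => by simpa using hA₂B h)] at hc
    have := (h₂' z₂ hzA₂).2.2
    omega

theorem PathIn.uncons {S : Set V} {x y : V} {m : ℕ} (h : PathIn G S x y (m + 1)) :
    ∃ z, G.Adj x z ∧ PathIn G (S \ {x}) z y m := by
  obtain ⟨p, hp, hpl, hps⟩ := h
  cases p with
  | nil => simp at hpl
  | cons hxz q =>
    rw [Walk.cons_isPath_iff] at hp
    refine ⟨_, hxz, q, hp.1, by simpa using hpl, fun v hv => ⟨hps v (by simp [hv]), ?_⟩⟩
    rintro rfl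
    exact hp.2 hv

/-- There are only |A| + 1 candidates for the neighbours of a vertex of `A`, so all of them must be
neighbours. -/
theorem isClique_of_card_lt_degIn {A : Finset V} {x y : V}
    (h : ∀ v ∈ A, A.card + 1 ≤ degIn G (insert x (insert y A)) v) :
    G.IsClique A ∧ ∀ v ∈ A, G.Adj v x ∧ G.Adj v y ∧
      degIn G (insert x (insert y A)) v ≤ A.card + 1 := by
  have hT : ∀ v ∈ A, (A.erase v ∪ {x, y}).card ≤ A.card + 1 := by
    intro v hv
    refine (Finset.card_union_le _ _).trans ?_
    have h2 : ({x, y} : Finset V).card ≤ 2 := Finset.card_le_two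
    have h3 := Finset.card_erase_of_mem hv
    have h4 := Finset.card_pos.2 ⟨v, hv⟩
    omega
  have hsub : ∀ v ∈ A, ∀ w ∈ insert x (insert y A), G.Adj v w → w ∈ A.erase v ∪ {x, y} := by
    intro v hv w hw hvw
    simp only [Finset.mem_union, Finset.mem_erase, Finset.mem_insert, Finset.mem_singleton] at hw ⊢
    have := hvw.ne'
    tauto
  have hall : ∀ v ∈ A, ∀ w ∈ A.erase v ∪ {x, y}, G.Adj v w := fun v hv =>
    adj_of_card_le_degIn (hsub v hv) ((hT v hv).trans (h v hv))
  refine ⟨fun v hv w hw hvw => hall v hv w ?_, fun v hv => ⟨hall v hv x (by simp),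
    hall v hv y (by simp), (degIn_le_card (hsub v hv)).trans (hT v hv)⟩⟩
  rw [Finset.mem_union, Finset.mem_erase]
  exact Or.inl ⟨hvw.symm, hw⟩

/-- The path version of the Erdős–Gallai theorem. -/
theorem exists_pathIn_of_le_degIn {A : Finset V} {x y : V} {k : ℕ} (hx : x ∉ A) (hy : y ∉ A)
    (hxy : x ≠ y) (hemp : A = ∅ → k ≤ 1 ∧ G.Adj x y)
    (h2 : TwoLinked G A (insert x (insert y A) : Finset V))
    (hdeg : ∀ v ∈ A, k ≤ degIn G (insert x (insert y A)) v) :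
    ∃ m, k ≤ m ∧ PathIn G (insert x (insert y A) : Finset V) x y m := by
  rcases A.eq_empty_or_nonempty with hA | ⟨z, hz⟩
  · obtain ⟨hk, hadj⟩ := hemp hA
    exact ⟨1, hk, PathIn.edge hadj (by simp) (by simp)⟩
  obtain ⟨A', hA'A, hzA', hconn, hcl⟩ := exists_component (G := G) A hz
  have hmono : ((insert x (insert y A') : Finset V) : Set V) ⊆
      (insert x (insert y A) : Finset V) := by
    exact_mod_cast Finset.insert_subset_insert _ (Finset.insert_subset_insert _ hA'A)
  have hnb : ∀ v ∈ A', ∀ w ∈ insert x (insert y A), G.Adj v w → w ∈ insert x (insert y A') := by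
    intro v hv w hw hvw
    simp only [Finset.mem_insert] at hw ⊢
    exact hw.imp_right (fun h => h.imp_right (fun h => hcl v hv w h hvw))
  have hdeg' : ∀ v ∈ A', k ≤ degIn G (insert x (insert y A')) v := by
    intro v hv
    refine (hdeg v (hA'A hv)).trans (Finset.card_le_card ?_)
    intro w hw
    rw [Finset.mem_filter] at hw ⊢
    exact ⟨hnb v hv w hw.1 hw.2, hw.2⟩
  rcases card_lt_or_exists_pathIn A'.card A' x y k le_rfl (fun h => hx (hA'A h))
    (fun h => hy (hA'A h)) hxy ⟨z, hzA'⟩ hconn (by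
      intro B hB hBne u
      obtain ⟨v, hv, w, hw, hwB, hwu, hvw⟩ := h2 B (hB.trans hA'A) hBne u
      exact ⟨v, hv, w, by exact_mod_cast hnb v (hB hv) w (by exact_mod_cast hw) hvw,
        hwB, hwu, hvw⟩) hdeg' with h | ⟨m, hm, hP⟩
  · obtain ⟨hclq, hall⟩ := isClique_of_card_lt_degIn (fun v hv => h.trans (hdeg' v hv))
    obtain ⟨f, hf, hP⟩ := exists_pathIn_of_isClique hclq hzA'
    have hP1 := (hP.cons (hall f hf).1.symm (fun h => hx (hA'A h))).link (hall z hzA').2.1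
      (PathIn.single (Set.mem_singleton y)) (by
        intro v hv hvy
        rw [Set.mem_singleton_iff] at hvy
        subst hvy
        rcases hv with h | h
        · exact hxy h.symm
        · exact hy (hA'A h))
    have h1 := hdeg' z hzA'
    have h2' := (hall z hzA').2.2
    have h3 := Finset.card_pos.2 ⟨z, hzA'⟩
    refine ⟨_, ?_, hP1.mono ((Set.union_subset (Set.insert_subset ?_ ?_) ?_).trans hmono)⟩
    · omega
    · simp
    · intro v hv
      simp only [Finset.coe_insert, Set.mem_insert_iff]
      exact Or.inr (Or.inr hv)
    · simp
  · exact ⟨m, by omega, hP.mono hmono⟩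

/-! ### The components of the graph off the cycle -/

/-- A locally maximal cycle with vertex set `Cs` in a 2-connected graph of minimum degree at
least `k`, with a clique `K` that contains all but at most `k - 1` vertices of the cycle. -/
structure NearClique [Fintype V] (G : SimpleGraph V) (Cs K : Finset V) (k c : ℕ) : Prop where
  three_le : 3 ≤ c
  listing : ∀ w ∈ Cs, ∃ a, IsCyclicListing G Cs c a ∧ a 0 = w
  card_eq : Cs.card = c
  opposed : ∀ (S : Finset V), (∀ s ∈ S, s ∉ Cs) → ∀ x y u w p, PathIn G S x y p → G.Adj x u →
    G.Adj y w → u ≠ w → Opposed G Cs c (p + 1) u w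
  isClique : G.IsClique K
  subset : K ⊆ Cs
  card_lt : (Cs \ K).card + 1 ≤ k
  le_degIn : ∀ v, k ≤ degIn G Finset.univ v
  two : ∀ (B : Finset V), B.Nonempty → ∀ z, (∃ u, u ∉ B ∧ u ≠ z) →
    ∃ v ∈ B, ∃ w, w ∉ B ∧ w ≠ z ∧ G.Adj v w

theorem card_missing {Cs K : Finset V} {c : ℕ} {a : ℕ → V} (ha : IsCyclicListing G Cs c a) :
    (missing a c K).card = (Cs \ K).card := by
  refine Finset.card_bij (fun i _ => a i) ?_ ?_ ?_
  · intro i hi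
    rw [mem_missing] at hi
    rw [Finset.mem_sdiff]
    exact ⟨by exact_mod_cast (ha.mem (a i)).2 ⟨i, hi.1, rfl⟩, by exact_mod_cast hi.2⟩
  · intro i hi j hj h
    exact ha.inj i j (mem_missing.1 hi).1 (mem_missing.1 hj).1 h
  · intro v hv
    rw [Finset.mem_sdiff] at hv
    obtain ⟨i, hi, rfl⟩ := (ha.mem v).1 (by exact_mod_cast hv.1)
    exact ⟨i, mem_missing.2 ⟨hi, by exact_mod_cast hv.2⟩, rfl⟩

/-- `H` is the vertex set of a component of `G - Cs`. -/
def IsComp (G : SimpleGraph V) (Cs H : Finset V) : Prop :=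
  H.Nonempty ∧ (∀ v ∈ H, v ∉ Cs) ∧ ConnOn G H ∧ ∀ v ∈ H, ∀ w, G.Adj v w → w ∈ H ∨ w ∈ Cs

namespace NearClique

variable [Fintype V] {Cs K : Finset V} {k c : ℕ} (h : NearClique G Cs K k c)
include h

/-- The count `add_card_le_missing_add`, freed from indices by listing the cycle from `w`; the
missed vertices number at most k - 1. -/
theorem add_card_erase_le {U : Finset V} {w : V} {p : ℕ} (hw : w ∈ Cs) (hU : U ⊆ Cs)
    (hUw : (U.erase w).Nonempty) (hp : 1 ≤ p)
    (h0 : ∀ u ∈ U, u ≠ w → Opposed G Cs c p w u)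
    (h1 : ∀ u ∈ U, ∀ u' ∈ U, u ≠ u' → Opposed G Cs c 1 u u') :
    p + (U.erase w).card ≤ k ∧
      (2 ≤ p → 2 ≤ (U.erase w).card → (∀ u ∈ U, ∀ u' ∈ U, u ≠ u' → Opposed G Cs c p u u') →
        p + (U.erase w).card + 1 ≤ k) := by
  obtain ⟨a, ha, rfl⟩ := h.listing w hw
  have hk := h.card_lt
  rw [← card_missing ha] at hk
  set I := (Finset.range c).filter (fun i => a i ∈ U.erase (a 0)) with hI
  have hIcard : I.card = (U.erase (a 0)).card := by
    refine Finset.card_bij (fun i _ => a i) ?_ ?_ ?_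
    · intro i hi
      exact (Finset.mem_filter.1 hi).2
    · intro i hi j hj hij
      rw [hI, Finset.mem_filter, Finset.mem_range] at hi hj
      exact ha.inj i j hi.1 hj.1 hij
    · intro v hv
      obtain ⟨i, hi, rfl⟩ := (ha.mem v).1 (by exact_mod_cast hU (Finset.mem_of_mem_erase hv))
      exact ⟨i, Finset.mem_filter.2 ⟨Finset.mem_range.2 hi, hv⟩, rfl⟩
  have hmem : ∀ i ∈ I, i < c ∧ a i ∈ U ∧ a i ≠ a 0 := by
    intro i hi
    rw [hI, Finset.mem_filter, Finset.mem_range, Finset.mem_erase] at hi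
    tauto
  have hne : ∀ i ∈ I, ∀ j ∈ I, i < j → a i ≠ a j := by
    intro i hi j hj hij he
    have := ha.inj i j (hmem i hi).1 (hmem j hj).1 he
    omega
  have key := ha.add_card_le_missing_add (K := K) h.isClique (I := I) (p := p)
    (by rw [← Finset.card_pos, hIcard, Finset.card_pos]; exact hUw)
    (by
      intro i hi
      refine ⟨Nat.pos_of_ne_zero ?_, (hmem i hi).1⟩
      rintro rfl
      exact (hmem 0 hi).2.2 rfl) hp
    (fun i hi => h0 _ (hmem i hi).2.1 (hmem i hi).2.2)
    (fun i hi j hj hij => h1 _ (hmem i hi).2.1 _ (hmem j hj).2.1 (hne i hi j hj hij))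
  rw [hIcard] at key
  refine ⟨by omega, fun hp2 hI2 hpp => ?_⟩
  have := key.2 hp2 hI2
    (fun i hi j hj hij => hpp _ (hmem i hi).2.1 _ (hmem j hj).2.1 (hne i hi j hj hij))
  omega

/-- The path makes every neighbour of `x` on the cycle other than `w` (m + 1)-opposed to `w`, and
the trivial path at `x` makes these neighbours pairwise 1-opposed. If `x` and `y` have the same
neighbours on the cycle, all pairs are (m + 1)-opposed, which is what the strict form needs. -/
theorem path_bound {H : Finset V} (hH : ∀ v ∈ H, v ∉ Cs) {x y w : V} {m : ℕ}
    (hP : PathIn G H x y m) (hw : w ∈ Cs) (hyw : G.Adj y w)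
    (hne : ((Cs.filter (G.Adj x)).erase w).Nonempty) :
    m + 1 + ((Cs.filter (G.Adj x)).erase w).card ≤ k ∧
      (Cs.filter (G.Adj x) = Cs.filter (G.Adj y) → 1 ≤ m →
        2 ≤ ((Cs.filter (G.Adj x)).erase w).card →
        m + 1 + ((Cs.filter (G.Adj x)).erase w).card + 1 ≤ k) := by
  have hx : x ∈ H := by exact_mod_cast hP.start_mem
  have key := h.add_card_erase_le (U := Cs.filter (G.Adj x)) (p := m + 1) hw
    (Finset.filter_subset _ _) hne (by omega)
    (fun u hu huw => (h.opposed H hH x y u w m hP (Finset.mem_filter.1 hu).2 hyw huw).symm)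
    (fun u hu u' hu' huu' => h.opposed H hH x x u u' 0 (PathIn.single (by exact_mod_cast hx))
      (Finset.mem_filter.1 hu).2 (Finset.mem_filter.1 hu').2 huu')
  refine ⟨key.1, fun heq hm h2 => key.2 (by omega) h2 fun u hu u' hu' huu' => ?_⟩
  rw [heq] at hu'
  exact h.opposed H hH x y u u' m hP (Finset.mem_filter.1 hu).2 (Finset.mem_filter.1 hu').2 huu'

theorem exists_mem_ne (z : V) : ∃ u ∈ Cs, u ≠ z := by
  have h3 : 1 < Cs.card := by rw [h.card_eq]; have := h.three_le; omega
  exact Finset.exists_mem_ne h3 z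

theorem le_add_degIn {H : Finset V} (hH : IsComp G Cs H) {v : V} (hv : v ∈ H) :
    k ≤ degIn G H v + degIn G Cs v :=
  (h.le_degIn v).trans (degIn_le_add fun w _ hvw => hH.2.2.2 v hv w hvw)

theorem exists_attachment {H B : Finset V} (hH : IsComp G Cs H) (hB : B ⊆ H) (hBne : B.Nonempty)
    (z : V) (hz : ∀ v ∈ B, ∀ w ∈ H, G.Adj v w → w ∈ B ∨ w = z) :
    ∃ v ∈ B, ∃ w ∈ Cs, w ≠ z ∧ G.Adj v w := by
  obtain ⟨u, hu, huz⟩ := h.exists_mem_ne z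
  obtain ⟨v, hv, w, hwB, hwz, hvw⟩ := h.two B hBne z ⟨u, fun hu' => hH.2.1 u (hB hu') hu, huz⟩
  refine ⟨v, hv, w, ?_, hwz, hvw⟩
  rcases hH.2.2.2 v (hB hv) w hvw with hw | hw
  · rcases hz v hv w hw hvw with h | h
    · exact absurd h hwB
    · exact absurd h hwz
  · exact hw

/-- At most `D` of the at least `k` neighbours of a vertex of `B` lie on the cycle, so the
Erdős–Gallai path theorem applies with k - D. -/
theorem exists_pathIn {H B : Finset V} (hH : IsComp G Cs H) {x y : V} {D : ℕ} (hBH : B ⊆ H)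
    (hxB : x ∉ B) (hyB : y ∉ B) (hxy : x ≠ y)
    (hemp : B = ∅ → k ≤ D + 1 ∧ G.Adj x y)
    (h2 : TwoLinked G B (insert x (insert y B) : Finset V))
    (hnb : ∀ v ∈ B, ∀ w ∈ H, G.Adj v w → w ∈ insert x (insert y B))
    (hD : ∀ v ∈ B, degIn G Cs v ≤ D) :
    ∃ m, k ≤ m + D ∧ PathIn G (insert x (insert y B) : Finset V) x y m := by
  obtain ⟨m, hm, hP⟩ := exists_pathIn_of_le_degIn (k := k - D) hxB hyB hxy
    (fun h => ⟨by have := (hemp h).1; omega, (hemp h).2⟩) h2 (by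
      intro v hv
      have h1 := h.le_add_degIn hH (hBH hv)
      have h2 := hD v hv
      have h3 : degIn G H v ≤ degIn G (insert x (insert y B)) v := by
        refine Finset.card_le_card fun w hw => ?_
        rw [Finset.mem_filter] at hw ⊢
        exact ⟨hnb v hv w hw.1 hw.2, hw.2⟩
      omega)
  exact ⟨m, by omega, hP⟩

end NearClique

theorem exists_adj_of_degIn_pos {S : Finset V} {v : V} (hv : 1 ≤ degIn G S v) :
    ∃ w ∈ S, G.Adj v w := by
  obtain ⟨w, hw⟩ := Finset.card_pos.1 hv
  rw [Finset.mem_filter] at hw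
  exact ⟨w, hw.1, hw.2⟩

theorem degIn_le_card_erase {S : Finset V} {v w : V} : degIn G S v ≤
    ((S.filter (G.Adj v)).erase w).card + 1 := by
  have := Finset.pred_card_le_card_erase (s := S.filter (G.Adj v)) (a := w)
  unfold degIn
  omega

namespace NearClique

variable [Fintype V] {Cs K : Finset V} {k c : ℕ} (h : NearClique G Cs K k c)
include h

/-- No vertex `b` of a component cuts off a part `B` of it, if `B` is smallest possible. -/
theorem eq_insert_of_minimal {H B : Finset V} {b : V} (hH : IsComp G Cs H) (hBH : B ⊆ H)
    (hBne : B.Nonempty) (hbH : b ∈ H) (hbB : b ∉ B)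
    (hBN : ∀ v ∈ B, ∀ w ∈ H, G.Adj v w → w ∈ B ∨ w = b)
    (hmin : ∀ B' ⊆ H, B'.Nonempty → ∀ b' ∈ H, b' ∉ B' →
      (∀ v ∈ B', ∀ w ∈ H, G.Adj v w → w ∈ B' ∨ w = b') → B.card ≤ B'.card) :
    H = insert b B := by
  by_contra hne
  have hsub : insert b B ⊆ H := Finset.insert_subset hbH hBH
  have hRne : (H \ insert b B).Nonempty := by
    rw [Finset.sdiff_nonempty]
    intro hs
    exact hne (hs.antisymm hsub)
  -- paths from a vertex of `B` to `b`
  obtain ⟨x', hx', hx'max⟩ := Finset.exists_max_image B (degIn G Cs) hBne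
  have hinner : ∀ x ∈ B, ∃ m, k ≤ m + degIn G Cs x' ∧ PathIn G (insert b B : Finset V) x b m := by
    intro x hx
    have hxb : x ≠ b := fun he => hbB (he ▸ hx)
    have hins : insert x (insert b (B.erase x)) = insert b B := by
      rw [Finset.insert_comm, Finset.insert_erase hx]
    have := h.exists_pathIn (x := x) (y := b) (D := degIn G Cs x') hH
      ((Finset.erase_subset x B).trans hBH) (by simp) (by simp [hbB]) hxb ?_ ?_ ?_ ?_
    · rwa [hins] at this
    · intro hemp
      have hBx : B = {x} := by
        rw [Finset.erase_eq_empty_iff] at hemp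
        exact hemp.resolve_left hBne.ne_empty
      constructor
      · have h1 := h.le_add_degIn hH (hBH hx)
        have h2 : degIn G H x ≤ ({b} : Finset V).card := degIn_le_card fun w hw hxw => by
          rcases hBN x hx w hw hxw with hw' | hw'
          · rw [hBx, Finset.mem_singleton] at hw'
            exact absurd hw'.symm hxw.ne
          · simp [hw']
        have h3 := hx'max x hx
        rw [Finset.card_singleton] at h2
        omega
      · obtain ⟨v, hv, w, hw, hwB, hvw⟩ := hH.2.2.1 B hBH hBne (fun he => by
          rw [he] at hbB
          exact hbB hbH)
        have hvx : v = x := by rw [hBx] at hv; simpa using hv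
        rw [← hvx, ← (hBN v hv w hw hvw).resolve_left hwB]
        exact hvw
    · rw [hins]
      intro B' hB' hB'ne z
      by_contra! hno
      have hB'B : B' ⊆ B := hB'.trans (Finset.erase_subset _ _)
      have hlt : B'.card < B.card :=
        Finset.card_lt_card ⟨hB'B, fun hs => by simpa using hB' (hs hx)⟩
      have hbB' : b ∉ B' := fun hb => hbB (hB'B hb)
      have hN : ∀ v ∈ B', ∀ w ∈ H, G.Adj v w → w ∈ B' ∨ (w = z ∧ z ∈ insert b B) := by
        intro v hv w hw hvw
        have hwS : w ∈ insert b B := by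
          rcases hBN v (hB'B hv) w hw hvw with h' | h'
          · exact Finset.mem_insert_of_mem h'
          · rw [h']; exact Finset.mem_insert_self _ _
        by_contra! hcc
        have hwz : w ≠ z := fun he => hcc.2 he (he ▸ hwS)
        exact hno v hv w (by exact_mod_cast hwS) hcc.1 hwz hvw
      by_cases hz : z ∈ insert b B \ B'
      · rw [Finset.mem_sdiff] at hz
        have := hmin B' (hB'B.trans hBH) hB'ne z (hsub hz.1) hz.2
          (fun v hv w hw hvw => (hN v hv w hw hvw).imp_right And.left)
        omega
      · have := hmin B' (hB'B.trans hBH) hB'ne b hbH hbB' (fun v hv w hw hvw => by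
          rcases hN v hv w hw hvw with h' | ⟨h', h''⟩
          · exact Or.inl h'
          · refine Or.inl ?_
            by_contra hwB'
            exact hz (Finset.mem_sdiff.2 ⟨h'', h' ▸ hwB'⟩))
        omega
    · intro v hv w hw hvw
      rw [hins, Finset.mem_insert]
      exact (hBN v (Finset.mem_of_mem_erase hv) w hw hvw).symm
    · intro v hv
      exact hx'max v (Finset.mem_of_mem_erase hv)
  -- paths from `b` to the rest
  have houter : ∀ y ∈ H, y ∉ B → ∃ l, PathIn G (H \ B : Finset V) b y l := by
    intro y hy hyB
    obtain ⟨R, hRH, hbR, hRconn, hRcl⟩ := exists_component (G := G) (H \ B) (x := b)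
      (by rw [Finset.mem_sdiff]; exact ⟨hbH, hbB⟩)
    have hall : B ∪ R = H := by
      by_contra hne'
      obtain ⟨v, hv, w, hw, hwBR, hvw⟩ := hH.2.2.1 (B ∪ R)
        (Finset.union_subset hBH (hRH.trans Finset.sdiff_subset))
        (hBne.mono Finset.subset_union_left) hne'
      rw [Finset.mem_union, not_or] at hwBR
      rcases Finset.mem_union.1 hv with hv | hv
      · rcases hBN v hv w hw hvw with h' | h'
        · exact hwBR.1 h'
        · exact hwBR.2 (h' ▸ hbR)
      · exact hwBR.2 (hRcl v hv w (Finset.mem_sdiff.2 ⟨hw, hwBR.1⟩) hvw)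
    have hyR : y ∈ R := by
      rw [← hall, Finset.mem_union] at hy
      exact hy.resolve_left hyB
    obtain ⟨l, hl⟩ := exists_pathIn_of_connOn hRconn hbR hyR
    exact ⟨l, hl.mono (by exact_mod_cast hRH)⟩
  have hpath : ∀ x ∈ B, ∀ y ∈ H, y ∉ B → ∃ m, k + (if y = b then 0 else 1) ≤
      m + degIn G Cs x' ∧ PathIn G H x y m := by
    intro x hx y hy hyB
    obtain ⟨m, hm, hP⟩ := hinner x hx
    obtain ⟨l, hl⟩ := houter y hy hyB
    refine ⟨m + l, ?_, (hP.trans hl ?_).mono ?_⟩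
    · split_ifs with hyb
      · omega
      · have := hl.pos (Ne.symm hyb)
        omega
    · intro v hv hv'
      simp only [Finset.coe_insert, Finset.coe_sdiff, Set.mem_insert_iff, Set.mem_sdiff,
        Finset.mem_coe] at hv hv'
      exact hv.resolve_right hv'.2
    · refine Set.union_subset (by exact_mod_cast hsub) ?_
      exact_mod_cast Finset.sdiff_subset
  obtain ⟨v₁, hv₁, u₁, hu₁, -, hvu₁⟩ := h.exists_attachment hH hBH hBne b hBN
  have hRB : ∀ v ∈ H \ insert b B, v ∈ H ∧ v ≠ b ∧ v ∉ B := by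
    intro v hv
    rw [Finset.mem_sdiff, Finset.mem_insert, not_or] at hv
    exact hv
  obtain ⟨v₂, hv₂, u₂, hu₂, -, hvu₂⟩ := h.exists_attachment hH
    (B := H \ insert b B) Finset.sdiff_subset hRne b (by
      intro v hv w hw hvw
      have hv' := hRB v hv
      by_cases hwb : w = b
      · exact Or.inr hwb
      · refine Or.inl (Finset.mem_sdiff.2 ⟨hw, ?_⟩)
        rw [Finset.mem_insert, not_or]
        refine ⟨hwb, fun hwB => ?_⟩
        rcases hBN w hwB v hv'.1 hvw.symm with h' | h'
        · exact hv'.2.2 h'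
        · exact hv'.2.1 h')
  have hv₂' := hRB v₂ hv₂
  -- If vertices of `B` have at most one attachment, the paths to the rest of `H` have length at
  -- least k - 1, which by `path_bound` forces equal attachments on both sides of the cut: all of
  -- `H` would attach to a single vertex. If `x'` has at least two, the extra edge beyond `b` on a
  -- path to `v₂` already violates `path_bound`.
  rcases Nat.lt_or_ge (degIn G Cs x') 2 with hD | hD
  · have hfin : ∀ x ∈ B, ∀ y ∈ H, y ∉ B → ∀ u ∈ Cs, ∀ w ∈ Cs, G.Adj x u → G.Adj y w → u = w := by
      intro x hx y hy hyB u hu w hw hxu hyw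
      by_contra huw
      obtain ⟨m, hm, hP⟩ := hpath x hx y hy hyB
      have hmem : u ∈ (Cs.filter (G.Adj x)).erase w := by simp [huw, hu, hxu]
      have h1 := (h.path_bound hH.2.1 hP hw hyw ⟨u, hmem⟩).1
      have h2 := Finset.card_pos.2 ⟨u, hmem⟩
      omega
    obtain ⟨v, hv, w, hw, hwu, hvw⟩ := h.exists_attachment hH subset_rfl hH.1 u₁
      (fun v _ w hw _ => Or.inl hw)
    have h12 := hfin v₁ hv₁ v₂ hv₂'.1 hv₂'.2.2 u₁ hu₁ u₂ hu₂ hvu₁ hvu₂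
    by_cases hvB : v ∈ B
    · exact hwu ((hfin v hvB v₂ hv₂'.1 hv₂'.2.2 w hw u₂ hu₂ hvw hvu₂).trans h12.symm)
    · exact hwu (hfin v₁ hv₁ v hv hvB u₁ hu₁ w hw hvu₁ hvw).symm
  · obtain ⟨m, hm, hP⟩ := hpath x' hx' v₂ hv₂'.1 hv₂'.2.2
    rw [if_neg hv₂'.2.1] at hm
    have hc := degIn_le_card_erase (G := G) (S := Cs) (v := x') (w := u₂)
    have h1 := (h.path_bound hH.2.1 hP hu₂ hvu₂ (Finset.card_pos.1 (by omega))).1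
    omega

/-- The components of `G - C` with at least two vertices are cliques on `k - 1` vertices that are
completely joined to two vertices of `C`. -/
theorem comp_structure {H : Finset V} (hH : IsComp G Cs H) (h2H : 2 ≤ H.card) :
    H.card + 1 = k ∧ G.IsClique H ∧ ∃ u ∈ Cs, ∃ w ∈ Cs, u ≠ w ∧
      ∀ v ∈ H, G.Adj v u ∧ G.Adj v w ∧ ∀ z ∈ Cs, G.Adj v z → z = u ∨ z = w := by
  -- a smallest part cut off by a vertex
  let Q : Finset V → V → Prop := fun B b => B ⊆ H ∧ B.Nonempty ∧ b ∈ H ∧ b ∉ B ∧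
    ∀ v ∈ B, ∀ w ∈ H, G.Adj v w → w ∈ B ∨ w = b
  have hex : ∃ m, ∃ B b, Q B b ∧ B.card = m := by
    obtain ⟨b, hb⟩ := hH.1
    refine ⟨_, H.erase b, b, ⟨Finset.erase_subset _ _, ?_, hb, by simp, ?_⟩, rfl⟩
    · rw [← Finset.card_pos, Finset.card_erase_of_mem hb]
      omega
    · intro v _ w hw _
      by_cases hwb : w = b
      · exact Or.inr hwb
      · exact Or.inl (Finset.mem_erase.2 ⟨hwb, hw⟩)
  obtain ⟨B, b, ⟨hBH, hBne, hbH, hbB, hBN⟩, hBcard⟩ := Nat.find_spec hex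
  have hmin : ∀ B' ⊆ H, B'.Nonempty → ∀ b' ∈ H, b' ∉ B' →
      (∀ v ∈ B', ∀ w ∈ H, G.Adj v w → w ∈ B' ∨ w = b') → B.card ≤ B'.card := by
    intro B' h1 h2 b' h3 h4 h5
    rw [hBcard]
    exact Nat.find_min' hex ⟨B', b', ⟨h1, h2, h3, h4, h5⟩, rfl⟩
  have hHB := h.eq_insert_of_minimal hH hBH hBne hbH hbB hBN hmin
  have hBc : H.card = B.card + 1 := by rw [hHB, Finset.card_insert_of_notMem hbB]
  -- long paths between any two vertices
  have hpath : ∀ x ∈ H, ∀ y ∈ H, x ≠ y → ∀ D, (∀ v ∈ H, v ≠ x → degIn G Cs v ≤ D) →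
      ∃ m, k ≤ m + D ∧ PathIn G H x y m := by
    intro x hx y hy hxy D hD
    have hyE : y ∈ H.erase x := Finset.mem_erase.2 ⟨hxy.symm, hy⟩
    have hins : insert x (insert y ((H.erase x).erase y)) = H := by
      rw [Finset.insert_erase hyE, Finset.insert_erase hx]
    have := h.exists_pathIn (x := x) (y := y) (D := D) (B := (H.erase x).erase y) hH
      ((Finset.erase_subset _ _).trans (Finset.erase_subset _ _)) (by simp) (by simp) hxy ?_ ?_ ?_ ?_
    · rwa [hins] at this
    · intro hemp
      rw [Finset.erase_eq_empty_iff] at hemp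
      have hHx : H.erase x = {y} := hemp.resolve_left (fun he => by rw [he] at hyE; simp at hyE)
      constructor
      · have h1 := h.le_add_degIn hH hy
        have h2 : degIn G H y ≤ ({x} : Finset V).card := degIn_le_card fun w hw hyw => by
          by_contra hwx
          have : w ∈ H.erase x := Finset.mem_erase.2 ⟨by simpa using hwx, hw⟩
          rw [hHx, Finset.mem_singleton] at this
          exact hyw.ne this.symm
        have h3 := hD y hy hxy.symm
        rw [Finset.card_singleton] at h2
        omega
      · obtain ⟨v, hv, w, hw, hwx, hvw⟩ := hH.2.2.1 {x} (by simpa using hx) (by simp) (by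
          intro he
          rw [← he, Finset.mem_singleton] at hy
          exact hxy hy.symm)
        rw [Finset.mem_singleton] at hv hwx
        have : w ∈ H.erase x := Finset.mem_erase.2 ⟨hwx, hw⟩
        rw [hHx, Finset.mem_singleton] at this
        rw [← hv, ← this]
        exact hvw
    · rw [hins]
      intro B' hB' hB'ne z
      by_contra! hno
      have hB'H : B' ⊆ H :=
        hB'.trans ((Finset.erase_subset _ _).trans (Finset.erase_subset _ _))
      have hc := Finset.card_le_card hB'
      rw [Finset.card_erase_of_mem hyE, Finset.card_erase_of_mem hx] at hc
      by_cases hz : z ∈ H \ B'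
      · rw [Finset.mem_sdiff] at hz
        have := hmin B' hB'H hB'ne z hz.1 hz.2 (by
          intro v hv w hw hvw
          by_contra! hcc
          exact hno v hv w (by exact_mod_cast hw) hcc.1 hcc.2 hvw)
        omega
      · have := hmin B' hB'H hB'ne x hx (fun hx' => by simpa using hB' hx') (by
          intro v hv w hw hvw
          refine Or.inl ?_
          by_contra hcc
          refine hno v hv w (by exact_mod_cast hw) hcc ?_ hvw
          rintro rfl
          exact hz (Finset.mem_sdiff.2 ⟨hw, hcc⟩))
        omega
    · intro v hv w hw _
      rwa [hins]
    · intro v hv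
      have hv' := Finset.mem_erase.1 (Finset.mem_erase.1 hv).2
      exact hD v hv'.2 hv'.1
  -- the two vertices with the most attachments
  obtain ⟨x, hx, hxmax⟩ := Finset.exists_max_image H (degIn G Cs) hH.1
  have hxne : (H.erase x).Nonempty := by
    rw [← Finset.card_pos, Finset.card_erase_of_mem hx]
    omega
  obtain ⟨y, hy, hymax⟩ := Finset.exists_max_image (H.erase x) (degIn G Cs) hxne
  obtain ⟨hyx, hyH⟩ := Finset.mem_erase.1 hy
  obtain ⟨v₀, hv₀, u₀, hu₀, -, hvu₀⟩ := h.exists_attachment hH (Finset.erase_subset x H) hxne x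
    (fun v _ w hw _ => by
      by_cases hwx : w = x
      · exact Or.inr hwx
      · exact Or.inl (Finset.mem_erase.2 ⟨hwx, hw⟩))
  have hypos : 1 ≤ degIn G Cs y := by
    refine le_trans ?_ (hymax v₀ hv₀)
    exact Finset.card_pos.2 ⟨u₀, by simp [hu₀, hvu₀]⟩
  obtain ⟨w, hw, hyw⟩ := exists_adj_of_degIn_pos hypos
  obtain ⟨m, hm, hP⟩ := hpath x hx y hyH hyx.symm (degIn G Cs y)
    (fun v hv hvx => hymax v (Finset.mem_erase.2 ⟨hvx, hv⟩))
  -- With at most one attachment per vertex, two vertices with different attachments would be joined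
  -- by a path of length at least k - 1, too long for `path_bound`.
  have hD2 : 2 ≤ degIn G Cs x := by
    by_contra hlt
    obtain ⟨v, hv, w', hw', hwu, hvw⟩ := h.exists_attachment hH subset_rfl hH.1 u₀
      (fun v _ w hw _ => Or.inl hw)
    have hv₀H := Finset.mem_of_mem_erase hv₀
    by_cases hvv : v = v₀
    · subst hvv
      have : 1 < degIn G Cs v := Finset.one_lt_card.2 ⟨w', by simp [hw', hvw], u₀,
        by simp [hu₀, hvu₀], hwu⟩
      have := hxmax v hv
      omega
    · obtain ⟨m, hm, hP⟩ := hpath v hv v₀ hv₀H hvv (degIn G Cs x) (fun v hv _ => hxmax v hv)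
      have hmem : w' ∈ (Cs.filter (G.Adj v)).erase u₀ := by simp [hwu, hw', hvw]
      have h1 := (h.path_bound hH.2.1 hP hu₀ hvu₀ ⟨w', hmem⟩).1
      have h2 := Finset.card_pos.2 ⟨w', hmem⟩
      omega
  have hc : ∀ {w}, degIn G Cs x ≤ ((Cs.filter (G.Adj x)).erase w).card + 1 := degIn_le_card_erase
  have hbd : ∀ w ∈ Cs, G.Adj y w → m + 1 + ((Cs.filter (G.Adj x)).erase w).card ≤ k := by
    intro w hw hyw
    have := hc (w := w)
    exact (h.path_bound hH.2.1 hP hw hyw (Finset.card_pos.1 (by omega))).1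
  -- Since m is at least k minus the number of attachments of `y`, and `y` has no more of them than
  -- `x`, `path_bound` must hold with equality: each attachment of `y` is one of `x`, and their
  -- numbers agree.
  have hsub : Cs.filter (G.Adj y) ⊆ Cs.filter (G.Adj x) := by
    intro z hz
    by_contra hzx
    have h1 := hbd z (Finset.mem_filter.1 hz).1 (Finset.mem_filter.1 hz).2
    rw [Finset.erase_eq_of_notMem hzx] at h1
    change m + 1 + degIn G Cs x ≤ k at h1
    have := hxmax y hyH
    omega
  have heq : Cs.filter (G.Adj y) = Cs.filter (G.Adj x) := by
    refine Finset.eq_of_subset_of_card_le hsub ?_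
    change degIn G Cs x ≤ degIn G Cs y
    have := hbd w hw hyw
    have := hc (w := w)
    omega
  have hdeq : degIn G Cs y = degIn G Cs x := by unfold degIn; rw [heq]
  -- With three or more common attachments the strict form of `path_bound` contradicts this
  -- equality.
  have hD : degIn G Cs x = 2 := by
    by_contra hne
    have h1 := hc (w := w)
    have h2 := (h.path_bound hH.2.1 hP hw hyw (Finset.card_pos.1 (by omega))).2 heq.symm
      (hP.pos hyx.symm) (by omega)
    omega
  obtain ⟨u, w, huw, hUx⟩ := Finset.card_eq_two.1 hD
  have hu : u ∈ Cs ∧ G.Adj x u := Finset.mem_filter.1 (by rw [hUx]; simp)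
  have hw : w ∈ Cs ∧ G.Adj x w := Finset.mem_filter.1 (by rw [hUx]; simp)
  have hatt : ∀ v ∈ H, ∀ z ∈ Cs, G.Adj v z → z = u ∨ z = w := by
    intro v hv z hz hvz
    by_contra hzuw
    have hzx : z ∉ Cs.filter (G.Adj x) := by rw [hUx]; simpa using hzuw
    have hvx : x ≠ v := by
      rintro rfl
      exact hzx (Finset.mem_filter.2 ⟨hz, hvz⟩)
    obtain ⟨m, hm, hP⟩ := hpath x hx v hv hvx (degIn G Cs x) (fun v hv _ => hxmax v hv)
    have hE : ((Cs.filter (G.Adj x)).erase z).card = 2 := by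
      rw [Finset.erase_eq_of_notMem hzx]
      exact hD
    have := (h.path_bound hH.2.1 hP hz hvz (Finset.card_pos.1 (by omega))).1
    omega
  have huH : u ∉ H := fun h' => hH.2.1 u h' hu.1
  have hwH : w ∉ H := fun h' => hH.2.1 w h' hw.1
  have hnb : ∀ v ∈ H, ∀ z, G.Adj v z → z ∈ insert u (insert w H) := by
    intro v hv z hvz
    simp only [Finset.mem_insert]
    rcases hH.2.2.2 v hv z hvz with h' | h'
    · exact Or.inr (Or.inr h')
    · exact (hatt v hv z h' hvz).imp_right Or.inl
  have hdeg : ∀ v ∈ H, k ≤ degIn G (insert u (insert w H)) v := by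
    intro v hv
    refine (h.le_degIn v).trans (Finset.card_le_card fun z hz => ?_)
    rw [Finset.mem_filter] at hz ⊢
    exact ⟨hnb v hv z hz.2, hz.2⟩
  have hlt : H.card + 1 ≤ k := by
    refine (card_lt_or_exists_pathIn H.card H u w k le_rfl huH hwH huw hH.1 hH.2.2.1 ?_
      hdeg).resolve_right ?_
    · intro B' hB' hB'ne z
      obtain ⟨t, ht, htz⟩ := h.exists_mem_ne z
      obtain ⟨v, hv, z', h1, h2, h3⟩ := h.two B' hB'ne z
        ⟨t, fun htB => hH.2.1 t (hB' htB) ht, htz⟩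
      exact ⟨v, hv, z', by exact_mod_cast hnb v (hB' hv) z' h3, h1, h2, h3⟩
    · rintro ⟨l, hl, hQ⟩
      -- The path has length at least k + 1 ≥ 2. Without its ends `u` and `w` it is a path in `H` of
      -- length at least k - 1, against `path_bound`.
      obtain ⟨l, rfl⟩ : ∃ l', l = l' + 1 + 1 := ⟨l - 2, by have := h.card_lt; omega⟩
      obtain ⟨s, hus, hQ⟩ := hQ.uncons
      obtain ⟨t, hwt, hQ⟩ := hQ.symm.uncons
      have hQ' : PathIn G H s t l := hQ.symm.mono (by
        intro v hv
        simp only [Finset.coe_insert, Set.mem_sdiff, Set.mem_insert_iff, Set.mem_singleton_iff,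
          Finset.mem_coe] at hv ⊢
        tauto)
      have hmem : u ∈ (Cs.filter (G.Adj s)).erase w := by simp [huw, hu.1, hus.symm]
      have h1 := (h.path_bound hH.2.1 hQ' hw.1 hwt.symm ⟨u, hmem⟩).1
      have h2 := Finset.card_pos.2 ⟨u, hmem⟩
      omega
  obtain ⟨hclq, hall⟩ := isClique_of_card_lt_degIn (fun v hv => hlt.trans (hdeg v hv))
  refine ⟨le_antisymm hlt ((hdeg x hx).trans (hall x hx).2.2), hclq, u, hu.1, w, hw.1, huw,
    fun v hv => ⟨(hall v hv).1, (hall v hv).2.1, hatt v hv⟩⟩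

end NearClique

/-! ### The cycle vertices off the clique -/

theorem IsCyclicListing.card_image {S : Set V} {c : ℕ} {a : ℕ → V} (ha : IsCyclicListing G S c a)
    {F : Finset ℕ} (hF : ∀ i ∈ F, i < c) : (F.image a).card = F.card :=
  Finset.card_image_of_injOn fun i hi j hj hij => ha.inj i j (hF i hi) (hF j hj) hij

/-- The vertices of an arc that is missed by the clique and is as short as its opposed ends allow have
no neighbours on the rest of the cycle. -/
theorem IsCyclicListing.nbr_of_missed_arc {Cs K : Finset V} {c p i : ℕ} {a : ℕ → V}
    (ha : IsCyclicListing G Cs c a) (hK : G.IsClique K) (hic : i < c) (hip : i = p + 1)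
    (hop : Opposed G Cs c p (a 0) (a i)) (hM : ∀ l < c, a l ∉ K ↔ 0 < l ∧ l < i) :
    ∀ y ∈ Cs \ K, ∀ z ∈ Cs, G.Adj y z → z ∈ Cs \ K ∨ z = a 0 ∨ z = a i := by
  intro y hy z hz hyz
  rw [Finset.mem_sdiff] at hy
  obtain ⟨s, hs, rfl⟩ := (ha.mem y).1 (by exact_mod_cast hy.1)
  obtain ⟨t, ht, rfl⟩ := (ha.mem z).1 (by exact_mod_cast hz)
  have hsi := (hM s hs).1 hy.2
  by_contra! hcon
  obtain ⟨h1, h2, h3⟩ := hcon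
  have htK : a t ∈ K := by
    by_contra htK
    exact h1 (Finset.mem_sdiff.2 ⟨hz, htK⟩)
  have hKmem : ∀ l < c, (l = 0 ∨ i ≤ l) → a l ∈ K := by
    intro l hl hl'
    by_contra hlK
    have := (hM l hl).1 hlK
    omega
  have hit : i < t := by
    have h5 : t ≠ 0 := by rintro rfl; exact h2 rfl
    have h6 : t ≠ i := by rintro rfl; exact h3 rfl
    by_contra hlt
    exact (hM t ht).2 ⟨by omega, by omega⟩ htK
  set F := (Finset.Ioo i c).image a with hF
  have hFc : F.card = c - i - 1 := by
    rw [hF, ha.card_image (by intro l hl; exact (Finset.mem_Ioo.1 hl).2), Nat.card_Ioo]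
  have hFcoe : (F : Set V) = a '' Set.Ioo i c := by simp [hF]
  have hFK : (F : Set V) ⊆ K := by
    rw [hFcoe]
    rintro _ ⟨l, hl, rfl⟩
    exact hKmem l hl.2 (Or.inr hl.1.le)
  have htF : a t ∈ F := Finset.mem_image.2 ⟨t, Finset.mem_Ioo.2 ⟨hit, ht⟩, rfl⟩
  obtain ⟨f, hf, hP⟩ := exists_pathIn_of_isClique (hK.subset hFK) htF
  have hf0 : G.Adj f (a 0) := by
    refine hK (hFK (by exact_mod_cast hf)) (hKmem 0 (by omega) (Or.inl rfl)) ?_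
    obtain ⟨l, hl, rfl⟩ := Finset.mem_image.1 hf
    rw [Finset.mem_Ioo] at hl
    intro he
    have := ha.inj l 0 hl.2 (by omega) he
    omega
  rw [hFcoe] at hP
  -- The path goes from `a i` back along the missed arc to `a s`, over the edge to `a t`, through
  -- every vertex of `F` and on to `a 0`. It leaves out only the s - 1 < p vertices between 0 and
  -- `s`.
  have h1 := (ha.arc hsi.2.le hic).symm.link hyz hP.symm (ha.disjoint_image
    (by rintro l ⟨h1, h2⟩; omega) (by rintro l ⟨h1, h2⟩; omega)
    (by rintro l ⟨h1, h2⟩ ⟨h3, h4⟩; omega))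
  rw [← Set.image_union] at h1
  have h2 := h1.link hf0 (PathIn.single (S := a '' {0}) (by simp)) (ha.disjoint_image
    (by rintro l (⟨h1, h2⟩ | ⟨h1, h2⟩) <;> omega) (by rintro l rfl; omega)
    (by rintro l (⟨h1, h2⟩ | ⟨h1, h2⟩) rfl <;> omega))
  have := hop.symm _ (h2.mono (Set.union_subset (ha.image_subset (by omega) _)
    (ha.image_subset (by omega) _)))
  omega

namespace NearClique

variable [Fintype V] {Cs K : Finset V} {k c : ℕ} (h : NearClique G Cs K k c)
include h

/-- The part of the cycle off the clique, if `G - C` has a component with more than one vertex. -/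
theorem missed_of_comp {H : Finset V} (hH : IsComp G Cs H) (h2H : 2 ≤ H.card) {u w : V}
    (hHk : H.card + 1 = k) (hHK : G.IsClique H) (hu : u ∈ Cs) (hw : w ∈ Cs) (huw : u ≠ w)
    (hadj : ∀ v ∈ H, G.Adj v u ∧ G.Adj v w) :
    u ∈ K ∧ w ∈ K ∧ (Cs \ K).card + 1 = k ∧
      (∀ y ∈ Cs \ K, ∀ z ∈ Cs, G.Adj y z → z ∈ Cs \ K ∨ z = u ∨ z = w) ∧
      ∃ y ∈ Cs \ K, ∃ z ∈ Cs \ K, G.Adj y z := by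
  obtain ⟨x, hx, y, hy, hxy⟩ := Finset.one_lt_card.1 h2H
  have hop := (h.opposed H hH.2.1 x y u w _ (pathIn_of_isClique hHK hx hy hxy) (hadj x hx).1
    (hadj y hy).2 huw).symm
  rw [show H.card - 1 + 1 = H.card by omega] at hop
  have hk := h.card_lt
  have hc3 := h.three_le
  suffices hsuff : ∀ a i, IsCyclicListing G Cs c a → i < c → i = H.card + 1 →
      Opposed G Cs c H.card (a 0) (a i) → (∀ l < c, a l ∉ K ↔ 0 < l ∧ l < i) →
      a 0 ∈ K ∧ a i ∈ K ∧ (Cs \ K).card + 1 = k ∧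
      (∀ y ∈ Cs \ K, ∀ z ∈ Cs, G.Adj y z → z ∈ Cs \ K ∨ z = a 0 ∨ z = a i) ∧
      ∃ y ∈ Cs \ K, ∃ z ∈ Cs \ K, G.Adj y z by
    obtain ⟨a, ha, rfl⟩ := h.listing w hw
    obtain ⟨i, hi, rfl⟩ := (ha.mem u).1 (by exact_mod_cast hu)
    have hi0 : 0 < i := Nat.pos_of_ne_zero (by rintro rfl; exact huw rfl)
    have hMc := card_missing (K := K) ha
    rcases ha.arc_missing (K := K) h.isClique hi0 hi hop (by omega) (by omega) with
      ⟨hm, hip⟩ | ⟨hm, hcp⟩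
    · obtain ⟨h1, h2, h3, h4, h5⟩ := hsuff a i ha hi hip hop (fun l hl => by
        rw [← hm l hl, mem_missing]
        simp [hl])
      exact ⟨h2, h1, h3, fun y hy z hz hyz => (h4 y hy z hz hyz).imp_right Or.symm, h5⟩
    · have hci : a (c - i + i) = a 0 := by
        rw [show c - i + i = 0 + c by omega, ha.per]
      -- The other arc is missed; starting the listing at `a i` moves it to the front and exchanges
      -- `u` and `w`.
      obtain ⟨h1, h2, h3, h4, h5⟩ := hsuff (fun j => a (j + i)) (c - i) (ha.rotate (by omega) i)
        (by omega) (by omega) (by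
          simp only [hci, Nat.zero_add]
          exact hop.symm) (by
          intro l hl
          have hmod := ha.apply_mod (l + i)
          have hlt : (l + i) % c < c := Nat.mod_lt _ (by omega)
          have key := hm _ hlt
          simp only [mem_missing, Finset.mem_coe, hmod, hlt, true_and] at key
          simp only [key, and_true]
          rcases Nat.lt_or_ge (l + i) c with h | h
          · rw [Nat.mod_eq_of_lt h]
            omega
          · rw [Nat.mod_eq_sub_mod h, Nat.mod_eq_of_lt (by omega)]
            omega)
      simp only [hci, Nat.zero_add] at h1 h2 h4
      exact ⟨h1, h2, h3, h4, h5⟩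
  intro a i ha hic hip hop hM
  have hmem : ∀ l < c, 0 < l → l < i → a l ∈ Cs \ K := by
    intro l hl h0 hli
    rw [Finset.mem_sdiff]
    exact ⟨by exact_mod_cast ha.mem_apply (by omega) l, (hM l hl).2 ⟨h0, hli⟩⟩
  refine ⟨?_, ?_, ?_, ha.nbr_of_missed_arc h.isClique hic hip hop hM,
    a 1, hmem 1 (by omega) (by omega) (by omega), a 2, hmem 2 (by omega) (by omega) (by omega),
    ha.adj 1⟩
  · by_contra hK
    have := (hM 0 (by omega)).1 hK
    omega
  · by_contra hK
    have := (hM i hic).1 hK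
    omega
  · have hsub : (Finset.Ioo 0 i).image a ⊆ Cs \ K := by
      intro v hv
      obtain ⟨l, hl, rfl⟩ := Finset.mem_image.1 hv
      rw [Finset.mem_Ioo] at hl
      exact hmem l (by omega) hl.1 hl.2
    have := Finset.card_le_card hsub
    rw [ha.card_image (by intro l hl; have := (Finset.mem_Ioo.1 hl).2; omega), Nat.card_Ioo] at this
    omega

/-- The part of the cycle off the clique, if `G - C` has an isolated vertex. -/
theorem missed_of_isolated {x : V} (hx : IsComp G Cs {x}) :
    (Cs.filter (G.Adj x)).card = k ∧ (Cs \ K).card + 1 = k ∧ 2 ≤ k ∧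
      Cs.filter (G.Adj x) ⊆ K ∧
      ∀ y ∈ Cs \ K, ∀ z ∈ Cs, G.Adj y z → z ∈ Cs.filter (G.Adj x) := by
  set U := Cs.filter (G.Adj x) with hU
  have hxx : PathIn G ({x} : Finset V) x x 0 := PathIn.single (by simp)
  have hopp : ∀ u ∈ U, ∀ w ∈ U, u ≠ w → Opposed G Cs c 1 u w := fun u hu w hw huw =>
    h.opposed {x} hx.2.1 x x u w 0 hxx (Finset.mem_filter.1 hu).2 (Finset.mem_filter.1 hw).2 huw
  have hUk : k ≤ U.card := by
    have h1 := h.le_add_degIn hx (v := x) (by simp)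
    have h2 : degIn G {x} x ≤ (∅ : Finset V).card := degIn_le_card fun w hw hxw => by
      rw [Finset.mem_singleton] at hw
      exact absurd hw.symm hxw.ne
    rw [Finset.card_empty] at h2
    change k ≤ degIn G Cs x
    omega
  have hU2 : 2 ≤ U.card := by
    obtain ⟨v, hv, u, hu, -, hvu⟩ := h.exists_attachment hx subset_rfl hx.1 x
      (fun v _ w hw _ => Or.inl hw)
    obtain ⟨v', hv', w, hw, hwu, hvw⟩ := h.exists_attachment hx subset_rfl hx.1 u
      (fun v _ w hw _ => Or.inl hw)
    rw [Finset.mem_singleton] at hv hv'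
    subst hv hv'
    exact Finset.one_lt_card.2 ⟨u, by simp [hU, hu, hvu], w, by simp [hU, hw, hvw], hwu.symm⟩
  have hUk' : U.card = k := by
    refine le_antisymm ?_ hUk
    obtain ⟨w, hw⟩ := Finset.card_pos.1 (show 0 < U.card by omega)
    have hw' := Finset.mem_filter.1 hw
    have h1 := Finset.card_erase_of_mem hw
    have := (h.path_bound hx.2.1 hxx hw'.1 hw'.2 (by
      rw [← hU]
      exact Finset.card_pos.1 (by omega))).1
    rw [← hU] at this
    omega
  have hk := h.card_lt
  have hc3 := h.three_le
  -- a listing that starts at a vertex of `U`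
  have hlist : ∀ a, IsCyclicListing G Cs c a → a 0 ∈ U → ∀ J : Finset ℕ,
      (∀ i, i ∈ J ↔ i < c ∧ a i ∈ U) →
      (∀ i ∈ J, ∀ j ∈ J, i < j → i + 2 ≤ j ∧ j + 2 ≤ c + i) ∧ (∀ i ∈ J, i + 1 < c) ∧
      (missing a c K).card + 1 = k ∧ missing a c K ⊆ J.image (· + 1) ∧ J.card = k ∧
      (∀ i ∈ missing a c K, i + 1 ∈ J ∨ i + 1 = c) := by
    intro a ha ha0 J hJ
    have hJc : J.card = k := by
      rw [← hUk', ← ha.card_image (fun i hi => ((hJ i).1 hi).1)]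
      congr 1
      ext v
      simp only [Finset.mem_image, hJ]
      constructor
      · rintro ⟨i, hi, rfl⟩
        exact hi.2
      · intro hv
        obtain ⟨i, hi, rfl⟩ := (ha.mem v).1 (by exact_mod_cast (Finset.mem_filter.1 hv).1)
        exact ⟨i, ⟨hi, hv⟩, rfl⟩
    have hJo : ∀ i ∈ J, ∀ j ∈ J, i < j → Opposed G Cs c 1 (a i) (a j) := by
      intro i hi j hj hij
      have hi' := (hJ i).1 hi
      have hj' := (hJ j).1 hj
      refine hopp _ hi'.2 _ hj'.2 fun he => ?_
      have := ha.inj i j hi'.1 hj'.1 he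
      omega
    have hgap : ∀ i ∈ J, ∀ j ∈ J, i < j → i + 2 ≤ j ∧ j + 2 ≤ c + i := by
      intro i hi j hj hij
      have := ha.gap hij ((hJ j).1 hj).1 (hJo i hi j hj hij)
      omega
    have h0J : 0 ∈ J := (hJ 0).2 ⟨by omega, ha0⟩
    have hlast : ∀ i ∈ J, i + 1 < c := by
      intro i hi
      rcases Nat.eq_zero_or_pos i with rfl | hi0
      · omega
      · have := hgap 0 h0J i hi hi0
        omega
    have hMc := card_missing (K := K) ha
    have e1 := ha.card_le_missing_succ (K := K) h.isClique (E := J.image (· + 1)) (by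
      intro e he
      obtain ⟨i, hi, rfl⟩ := Finset.mem_image.1 he
      exact hlast i hi) (by
      intro e he f hf hef
      obtain ⟨i, hi, rfl⟩ := Finset.mem_image.1 he
      obtain ⟨j, hj, rfl⟩ := Finset.mem_image.1 hf
      have hij : i < j := by simpa using hef
      exact ha.not_adj_succ hij (hlast j hj) (hJo i hi j hj hij))
    rw [Finset.card_image_of_injective _ (add_left_injective 1), hJc] at e1
    -- At least k - 1 of the k successors are missed and at most k - 1 vertices are missed in all,
    -- so every missed vertex is a successor of an attachment. The same count below makes it a
    -- predecessor.
    have e2 : J.image (· + 1) ∩ missing a c K = missing a c K :=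
      Finset.eq_of_subset_of_card_le Finset.inter_subset_right (by omega)
    have hMcard : (missing a c K).card + 1 = k := by
      rw [e2] at e1
      omega
    -- predecessors
    have hpos : ∀ i ∈ insert c (J.erase 0), 1 ≤ i ∧ i ≤ c := by
      intro i hi
      rcases Finset.mem_insert.1 hi with rfl | hi
      · omega
      · have h1 := Finset.mem_erase.1 hi
        have := hlast i h1.2
        omega
    have hinj : ((insert c (J.erase 0)).image (· - 1)).card = k := by
      rw [Finset.card_image_of_injOn (by
        intro i hi j hj hij
        have h1 := hpos i hi
        have h2 := hpos j hj
        simp only at hij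
        omega), Finset.card_insert_of_notMem (by
          intro hcJ
          have := hlast c (Finset.mem_of_mem_erase hcJ)
          omega), Finset.card_erase_of_mem h0J, hJc]
      omega
    have e3 := ha.card_le_missing_succ (K := K) h.isClique
      (E := (insert c (J.erase 0)).image (· - 1)) (by
      intro e he
      obtain ⟨i, hi, rfl⟩ := Finset.mem_image.1 he
      have := hpos i hi
      omega) (by
      intro e he f hf hef
      obtain ⟨i, hi, rfl⟩ := Finset.mem_image.1 he
      obtain ⟨j, hj, rfl⟩ := Finset.mem_image.1 hf
      have hi' := hpos i hi
      have hj' := hpos j hj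
      have hij : i < j := by omega
      have hiJ : i ∈ J := by
        rcases Finset.mem_insert.1 hi with rfl | hi
        · omega
        · exact Finset.mem_of_mem_erase hi
      rcases Finset.mem_insert.1 hj with rfl | hj
      · exact ha.not_adj_pred_zero (by omega) hij (hJo 0 h0J i hiJ (by omega))
      · have hjJ := Finset.mem_of_mem_erase hj
        exact ha.not_adj_pred (by omega) hij ((hJ j).1 hjJ).1 (hJo i hiJ j hjJ hij))
    have e4 : (insert c (J.erase 0)).image (· - 1) ∩ missing a c K = missing a c K :=
      Finset.eq_of_subset_of_card_le Finset.inter_subset_right (by omega)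
    refine ⟨hgap, hlast, hMcard, ?_, hJc, ?_⟩
    · rw [← e2]
      exact Finset.inter_subset_left
    · intro i hi
      rw [← e4] at hi
      obtain ⟨j, hj, hji⟩ := Finset.mem_image.1 (Finset.mem_inter.1 hi).1
      have hj' := hpos j hj
      rcases Finset.mem_insert.1 hj with rfl | hj
      · exact Or.inr (by omega)
      · have : i + 1 = j := by omega
        exact Or.inl (this ▸ Finset.mem_of_mem_erase hj)
  obtain ⟨w, hw⟩ := Finset.card_pos.1 (show 0 < U.card by omega)
  -- start at the vertex of `U` whose successor is in `K`
  have hstart : ∃ a, IsCyclicListing G Cs c a ∧ a 0 ∈ U ∧ a 1 ∈ K := by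
    obtain ⟨a, ha, rfl⟩ := h.listing w (Finset.mem_filter.1 hw).1
    obtain ⟨-, hlast, hMc, -, hJc, -⟩ := hlist a ha hw
      ((Finset.range c).filter (fun i => a i ∈ U)) (by simp)
    set J := (Finset.range c).filter (fun i => a i ∈ U) with hJ
    have : ¬ J.image (· + 1) ⊆ missing a c K := by
      intro hsub
      have := Finset.card_le_card hsub
      rw [Finset.card_image_of_injective _ (add_left_injective 1)] at this
      omega
    obtain ⟨e, he, heM⟩ := Finset.not_subset.1 this
    obtain ⟨i, hi, rfl⟩ := Finset.mem_image.1 he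
    refine ⟨fun j => a (j + i), ha.rotate (by omega) i, ?_, ?_⟩
    · rw [hJ, Finset.mem_filter] at hi
      simpa using hi.2
    · have hi' := hlast i hi
      by_contra hK
      refine heM (mem_missing.2 ⟨hi', ?_⟩)
      rw [Nat.add_comm]
      exact_mod_cast hK
  obtain ⟨a, ha, ha0, ha1⟩ := hstart
  obtain ⟨hgap, hlast, hMc, hsuc, hJc, hpre⟩ := hlist a ha ha0
    ((Finset.range c).filter (fun i => a i ∈ U)) (by simp)
  set J := (Finset.range c).filter (fun i => a i ∈ U) with hJ
  have hJmem : ∀ i, i ∈ J ↔ i < c ∧ a i ∈ U := by simp [hJ]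
  have h0J : 0 ∈ J := (hJmem 0).2 ⟨by omega, ha0⟩
  have h1M : 1 ∉ missing a c K := fun h' => (mem_missing.1 h').2 ha1
  have hMpred : ∀ i ∈ missing a c K, 1 ≤ i ∧ i - 1 ∈ J := by
    intro i hi
    obtain ⟨j, hj, rfl⟩ := Finset.mem_image.1 (hsuc hi)
    exact ⟨by simp, by simpa using hj⟩
  have hMsucc : ∀ i ∈ J, i ≠ 0 → i + 1 ∈ missing a c K := by
    have he : missing a c K = (J.image (· + 1)).erase 1 := by
      refine Finset.eq_of_subset_of_card_le (fun i hi => Finset.mem_erase.2 ⟨?_, hsuc hi⟩) ?_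
      · rintro rfl
        exact h1M hi
      · rw [Finset.card_erase_of_mem (Finset.mem_image.2 ⟨0, h0J, rfl⟩),
          Finset.card_image_of_injective _ (add_left_injective 1)]
        omega
    intro i hi hi0
    rw [he, Finset.mem_erase]
    exact ⟨by omega, Finset.mem_image.2 ⟨i, hi, rfl⟩⟩
  have hJM : ∀ i ∈ J, i ∉ missing a c K := by
    intro i hi hiM
    obtain ⟨h1, h2⟩ := hMpred i hiM
    have := hgap _ h2 i hi (by omega)
    omega
  have hKof : ∀ i < c, i ∉ missing a c K → a i ∈ K := by
    intro i hi hiM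
    by_contra hK
    exact hiM (mem_missing.2 ⟨hi, by exact_mod_cast hK⟩)
  refine ⟨hUk', by rw [← card_missing ha]; exact hMc, by omega, ?_, ?_⟩
  · intro u hu
    obtain ⟨i, hi, rfl⟩ := (ha.mem u).1 (by exact_mod_cast (Finset.mem_filter.1 hu).1)
    exact hKof i hi (hJM i ((hJmem i).2 ⟨hi, hu⟩))
  -- the first other vertex of `U`
  have hJ0 : (J.erase 0).Nonempty := by
    rw [← Finset.card_pos, Finset.card_erase_of_mem h0J]
    omega
  obtain ⟨g, hg, hgmin⟩ := Finset.exists_min_image (J.erase 0) id hJ0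
  simp only [id] at hgmin
  obtain ⟨hg0, hgJ⟩ := Finset.mem_erase.1 hg
  have hgc := ((hJmem g).1 hgJ).1
  -- The cycle now has a rigid layout: attachment 0, a stretch of `K` up to the attachment `g`, then
  -- missed vertices and attachments in alternation back to 0.
  have hafter : ∀ i, g ≤ i → i < c → i ∈ J ∨ i ∈ missing a c K := by
    intro i hi
    induction i, hi using Nat.le_induction with
    | base => exact fun _ => Or.inl hgJ
    | succ i hi ih =>
      intro hic
      rcases ih (by omega) with h' | h'
      · exact Or.inr (hMsucc i h' (by omega))
      · exact Or.inl ((hpre i h').resolve_right (by omega))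
  have hbefore : ∀ i, 1 ≤ i → i < g → i ∉ missing a c K := by
    intro i hi hig hiM
    have h2 := (hMpred i hiM).2
    rcases Nat.eq_zero_or_pos (i - 1) with h0 | h0
    · rw [show i = 1 by omega] at hiM
      exact h1M hiM
    · have := hgmin (i - 1) (Finset.mem_erase.2 ⟨by omega, h2⟩)
      omega
  intro y hy z hz hyz
  rw [Finset.mem_sdiff] at hy
  obtain ⟨s, hs, rfl⟩ := (ha.mem y).1 (by exact_mod_cast hy.1)
  obtain ⟨t, ht, rfl⟩ := (ha.mem z).1 (by exact_mod_cast hz)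
  have hsM : s ∈ missing a c K := mem_missing.2 ⟨hs, by exact_mod_cast hy.2⟩
  obtain ⟨hs1, hsJ⟩ := hMpred s hsM
  by_contra htU
  have hJo : ∀ i ∈ J, ∀ j ∈ J, i < j → Opposed G Cs c 1 (a i) (a j) := by
    intro i hi j hj hij
    have hi' := (hJmem i).1 hi
    have hj' := (hJmem j).1 hj
    refine hopp _ hi'.2 _ hj'.2 fun he => ?_
    have := ha.inj i j hi'.1 hj'.1 he
    omega
  by_cases htM : t ∈ missing a c K
  · obtain ⟨ht1, htJ⟩ := hMpred t htM
    rcases Nat.lt_trichotomy s t with hst | rfl | hst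
    · have := ha.not_adj_succ (show s - 1 < t - 1 by omega) (by omega)
        (hJo _ hsJ _ htJ (by omega))
      rw [Nat.sub_add_cancel hs1, Nat.sub_add_cancel ht1] at this
      exact this hyz
    · exact hyz.ne rfl
    · have := ha.not_adj_succ (show t - 1 < s - 1 by omega) (by omega)
        (hJo _ htJ _ hsJ (by omega))
      rw [Nat.sub_add_cancel hs1, Nat.sub_add_cancel ht1] at this
      exact this hyz.symm
  have htJ : t ∉ J := fun h' => htU ((hJmem t).1 h').2
  have ht0 : t ≠ 0 := by
    rintro rfl
    exact htJ h0J
  have htg : t < g := by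
    by_contra hlt
    rcases hafter t (by omega) ht with h' | h'
    · exact htJ h'
    · exact htM h'
  have hsg : g < s := by
    have h1 : ¬ s < g := fun h' => hbefore s hs1 h' hsM
    have h2 : s ≠ g := by
      rintro rfl
      exact hJM s hgJ hsM
    omega
  set F := (Finset.Ico 1 g).image a with hF
  have hFc : F.card = g - 1 := by
    rw [hF, ha.card_image (by intro l hl; have := (Finset.mem_Ico.1 hl).2; omega), Nat.card_Ico]
  have hFcoe : (F : Set V) = a '' Set.Ico 1 g := by simp [hF]
  have hFK : (F : Set V) ⊆ K := by
    rw [hFcoe]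
    rintro _ ⟨l, hl, rfl⟩
    exact hKof l (by have := hl.2; omega) (hbefore l hl.1 hl.2)
  have htF : a t ∈ F := Finset.mem_image.2 ⟨t, Finset.mem_Ico.2 ⟨by omega, htg⟩, rfl⟩
  obtain ⟨f, hf, hP⟩ := exists_pathIn_of_isClique (h.isClique.subset hFK) htF
  have hgf : G.Adj (a g) f := by
    refine h.isClique (hKof g hgc (hJM g hgJ)) (hFK (by exact_mod_cast hf)) ?_
    obtain ⟨l, hl, rfl⟩ := Finset.mem_image.1 hf
    rw [Finset.mem_Ico] at hl
    intro he
    have := ha.inj g l hgc (by omega) he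
    omega
  rw [hFcoe] at hP
  -- The path from `a (s - 1)` back to `a g`, through the whole clique stretch `F` to `a t`, over
  -- the edge to `a s` and around to `a 0` leaves out no vertex of the cycle, yet both its ends are
  -- attachments of `x`.
  have h1 := (ha.arc (show g ≤ s - 1 by omega) (by omega)).symm.link hgf hP (ha.disjoint_image
    (by rintro l ⟨h1, h2⟩; omega) (by rintro l ⟨h1, h2⟩; omega)
    (by rintro l ⟨h1, h2⟩ ⟨h3, h4⟩; omega))
  rw [← Set.image_union] at h1
  have h2 := h1.link hyz.symm (ha.wrap (show 0 < s by omega) hs) (ha.disjoint_image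
    (by rintro l (⟨h1, h2⟩ | ⟨h1, h2⟩) <;> omega)
    (by rintro l (⟨h1, h2⟩ | ⟨h1, h2⟩) <;> omega)
    (by rintro l (⟨h1, h2⟩ | ⟨h1, h2⟩) (⟨h3, h4⟩ | ⟨h3, h4⟩) <;> omega))
  have := (hJo 0 h0J _ hsJ (by omega)).symm _ (h2.mono (Set.union_subset
    (ha.image_subset (by omega) _) (ha.image_subset (by omega) _)))
  omega

end NearClique

/-! ### Recognising W and Z -/

/-- Every finite set `A` can be numbered by `0, …, |A| - 1`. -/
theorem exists_numbering (α : Type*) : ∃ g : Finset α → α → ℕ,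
    ∀ A, Set.InjOn (g A) A ∧ ∀ x ∈ A, g A x < A.card := by
  have : ∀ A : Finset α, ∃ f : α → ℕ, Set.InjOn f A ∧ ∀ x ∈ A, f x < A.card := by
    intro A
    refine ⟨fun x => if hx : x ∈ A then (A.equivFin ⟨x, hx⟩).val else 0, ?_, ?_⟩
    · intro x hx y hy hxy
      have hx' : x ∈ A := hx
      have hy' : y ∈ A := hy
      simp only [hx', hy', dif_pos] at hxy
      simpa using A.equivFin.injective (Fin.ext hxy)
    · intro x hx
      simp only [hx, dif_pos]
      exact (A.equivFin ⟨x, hx⟩).isLt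
  choose g hg using this
  exact ⟨g, hg⟩

theorem exists_equiv_of_injective [Fintype V] {n : ℕ} (hn : Fintype.card V = n) {f : V → ℕ}
    (hf : Function.Injective f) (hfn : ∀ v, f v < n) : ∃ e : V ≃ Fin n, ∀ v, (e v).val = f v := by
  have hinj : Function.Injective (fun v => (⟨f v, hfn v⟩ : Fin n)) := fun x y h =>
    hf (Fin.mk.inj_iff.1 h)
  exact ⟨Equiv.ofBijective _ ((Fintype.bijective_iff_injective_and_card _).2
    ⟨hinj, by simp [hn]⟩), fun v => rfl⟩

/-- Characterisation of the graphs `W_{n,k,c}`. -/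
theorem isW_of_neighbors [Fintype V] {n k c : ℕ} (hn : Fintype.card V = n) {K U : Finset V}
    (hK : G.IsClique K) (hKc : K.card + k = c + 1) (hUK : U ⊆ K) (hUk : U.card = k)
    (hkc : k ≤ c) (hout : ∀ v, v ∉ K → ∀ z, G.Adj v z ↔ z ∈ U) : IsW G n k c := by
  obtain ⟨g, hg⟩ := exists_numbering V
  have hKn : K.card ≤ n := hn ▸ Finset.card_le_univ K
  have hUKc := Finset.card_le_card hUK
  have hsd : (K \ U).card + U.card = K.card := Finset.card_sdiff_add_card_eq_card hUK
  have hco : K.card + (Kᶜ).card = n := by rw [Finset.card_add_card_compl, hn]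
  -- The numbering follows `graphW`: the k common neighbours, the rest of the clique, everything
  -- else.
  set f : V → ℕ := fun v => if v ∈ U then g U v else if v ∈ K then k + g (K \ U) v else
    K.card + g Kᶜ v with hf
  have f1 : ∀ v ∈ U, f v = g U v := fun v hv => by simp [hf, hv]
  have f2 : ∀ v ∈ K, v ∉ U → f v = k + g (K \ U) v := fun v hv hv' => by simp [hf, hv, hv']
  have f3 : ∀ v, v ∉ K → f v = K.card + g Kᶜ v := fun v hv => by
    have hvU : v ∉ U := fun h => hv (hUK h)
    simp [hf, hv, hvU]
  have b1 : ∀ v ∈ U, f v < k := fun v hv => by rw [f1 v hv, ← hUk]; exact (hg U).2 v hv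
  have b2 : ∀ v ∈ K, v ∉ U → k ≤ f v ∧ f v < K.card := fun v hv hv' => by
    have := (hg (K \ U)).2 v (Finset.mem_sdiff.2 ⟨hv, hv'⟩)
    rw [f2 v hv hv']
    omega
  have b3 : ∀ v, v ∉ K → K.card ≤ f v ∧ f v < n := fun v hv => by
    have := (hg Kᶜ).2 v (Finset.mem_compl.2 hv)
    rw [f3 v hv]
    omega
  have hU_iff : ∀ v, v ∈ U ↔ f v < k := by
    intro v
    refine ⟨b1 v, fun h => ?_⟩
    by_contra hv
    by_cases hvK : v ∈ K
    · have := b2 v hvK hv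
      omega
    · have := b3 v hvK
      omega
  have hK_iff : ∀ v, v ∈ K ↔ f v < K.card := by
    intro v
    constructor
    · intro hv
      by_cases hvU : v ∈ U
      · have := b1 v hvU
        omega
      · exact (b2 v hv hvU).2
    · intro h
      by_contra hv
      have := b3 v hv
      omega
  have hinj : Function.Injective f := by
    intro x y hxy
    by_cases hxU : x ∈ U
    · have hyU : y ∈ U := by rw [hU_iff, ← hxy, ← hU_iff]; exact hxU
      rw [f1 x hxU, f1 y hyU] at hxy
      exact (hg U).1 hxU hyU hxy
    · have hyU : y ∉ U := by rw [hU_iff, ← hxy, ← hU_iff]; exact hxU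
      by_cases hxK : x ∈ K
      · have hyK : y ∈ K := by rw [hK_iff, ← hxy, ← hK_iff]; exact hxK
        rw [f2 x hxK hxU, f2 y hyK hyU] at hxy
        exact (hg (K \ U)).1 (by simp [hxK, hxU]) (by simp [hyK, hyU]) (by omega)
      · have hyK : y ∉ K := by rw [hK_iff, ← hxy, ← hK_iff]; exact hxK
        rw [f3 x hxK, f3 y hyK] at hxy
        exact (hg Kᶜ).1 (by simp [hxK]) (by simp [hyK]) (by omega)
  have hfn : ∀ v, f v < n := by
    intro v
    by_cases hv : v ∈ K
    · have := (hK_iff v).1 hv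
      omega
    · exact (b3 v hv).2
  obtain ⟨e, he⟩ := exists_equiv_of_injective hn hinj hfn
  refine ⟨hkc, by omega, by omega, ⟨e, ?_⟩⟩
  intro x y
  have hs : c + 1 - k = K.card := by omega
  simp only [graphW, he, ne_eq, EmbeddingLike.apply_eq_iff_eq, hs]
  have nlt : ∀ v, K.card ≤ f v ↔ v ∉ K := fun v => by rw [hK_iff]; omega
  rw [← hU_iff, ← hU_iff, ← hK_iff, ← hK_iff, nlt, nlt]
  by_cases hxK : x ∈ K
  · by_cases hyK : y ∈ K
    · have : G.Adj x y ↔ x ≠ y := ⟨fun h => h.ne, fun h => hK hxK hyK h⟩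
      rw [this]
      tauto
    · have := hout y hyK x
      rw [adj_comm, this]
      have : x ≠ y := fun h => hyK (h ▸ hxK)
      tauto
  · have := hout x hxK y
    rw [this]
    have hyx : y ∈ K → x ≠ y := fun h h' => hxK (h' ▸ h)
    have := @hUK y
    have := @hUK x
    tauto

/-- Characterisation of the graphs `Z_{n,k,c}`. -/
theorem isZ_of_cliques [Fintype V] {n k c : ℕ} (hn : Fintype.card V = n) {K : Finset V} {u w : V}
    (hK : G.IsClique K) (hKc : K.card + k = c + 1) (hu : u ∈ K) (hw : w ∈ K) (huw : u ≠ w)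
    (hne : ∃ v, v ∉ K) (hadj : ∀ v, v ∉ K → ∀ z ∈ K, G.Adj v z ↔ z = u ∨ z = w)
    (hcl : ∀ v, v ∉ K → ∃ A : Finset V, v ∈ A ∧ A.card + 1 = k ∧ (∀ t ∈ A, t ∉ K) ∧
      G.IsClique A ∧ ∀ x ∈ A, ∀ z, z ∉ K → G.Adj x z → z ∈ A) : IsZ G n k c := by
  obtain ⟨g, hg⟩ := exists_numbering V
  obtain ⟨g', hg'⟩ := exists_numbering (Finset V)
  have hcl' : ∀ v, ∃ A : Finset V, v ∉ K → v ∈ A ∧ A.card + 1 = k ∧ (∀ t ∈ A, t ∉ K) ∧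
      G.IsClique A ∧ ∀ x ∈ A, ∀ z, z ∉ K → G.Adj x z → z ∈ A := by
    intro v
    by_cases hv : v ∈ K
    · exact ⟨∅, fun h => absurd hv h⟩
    · obtain ⟨A, hA⟩ := hcl v hv
      exact ⟨A, fun _ => hA⟩
  choose A hA using hcl'
  have hAeq : ∀ v, v ∉ K → ∀ t ∈ A v, A t = A v := by
    intro v hv t ht
    obtain ⟨-, hvc, hvK, -, hvcl⟩ := hA v hv
    have htK := hvK t ht
    obtain ⟨htA, htc, htK', htclq, -⟩ := hA t htK
    refine Finset.eq_of_subset_of_card_le (fun z hz => ?_) (by omega)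
    by_cases hzt : z = t
    · exact hzt ▸ ht
    · exact hvcl t ht z (htK' z hz) (htclq htA hz (Ne.symm hzt))
  have hAadj : ∀ v, v ∉ K → ∀ t, t ∉ K → v ≠ t → (G.Adj v t ↔ A v = A t) := by
    intro v hv t ht hvt
    obtain ⟨hvA, -, -, hvclq, hvcl⟩ := hA v hv
    constructor
    · intro h
      exact (hAeq v hv t (hvcl v hvA t ht h)).symm
    · intro h
      exact hvclq hvA (h ▸ (hA t ht).1) hvt
  set P : Finset (Finset V) := (Kᶜ).image A with hP
  have hAP : ∀ v, v ∉ K → A v ∈ P := fun v hv =>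
    Finset.mem_image.2 ⟨v, Finset.mem_compl.2 hv, rfl⟩
  have hco : K.card + (Kᶜ).card = n := by rw [Finset.card_add_card_compl, hn]
  have hPc : (Kᶜ).card = P.card * (k - 1) := by
    rw [Finset.card_eq_sum_card_image A Kᶜ, Finset.sum_const_nat]
    intro B hB
    obtain ⟨v, hv, rfl⟩ := Finset.mem_image.1 hB
    rw [Finset.mem_compl] at hv
    have : (Kᶜ).filter (fun t => A t = A v) = A v := by
      ext t
      rw [Finset.mem_filter, Finset.mem_compl]
      constructor
      · rintro ⟨h1, h2⟩
        exact h2 ▸ (hA t h1).1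
      · intro ht
        exact ⟨(hA v hv).2.2.1 t ht, hAeq v hv t ht⟩
    rw [this]
    have := (hA v hv).2.1
    omega
  have hk2 : 2 ≤ k := by
    obtain ⟨v, hv⟩ := hne
    obtain ⟨h1, h2, -⟩ := hA v hv
    have := Finset.card_pos.2 ⟨v, h1⟩
    omega
  have hK2 : 2 ≤ K.card := Finset.one_lt_card.2 ⟨u, hu, w, hw, huw⟩
  have hpair : ({u, w} : Finset V).card = 2 := Finset.card_pair huw
  have hpairK : ({u, w} : Finset V) ⊆ K := by
    intro v hv
    rw [Finset.mem_insert, Finset.mem_singleton] at hv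
    rcases hv with rfl | rfl <;> assumption
  have hsd : (K \ {u, w}).card + 2 = K.card := by
    rw [← hpair]
    exact Finset.card_sdiff_add_card_eq_card hpairK
  set U : Finset V := {u, w} with hU
  -- The numbering follows `graphZ`: `u` and `w`, the rest of `K`, then the small cliques in
  -- consecutive runs of k - 1, so that division by k - 1 recovers the clique.
  set f : V → ℕ := fun v => if v ∈ U then g U v else if v ∈ K then 2 + g (K \ U) v else
    K.card + (g' P (A v) * (k - 1) + g (A v) v) with hf
  have f1 : ∀ v ∈ U, f v = g U v := fun v hv => by simp [hf, hv]
  have f2 : ∀ v ∈ K, v ∉ U → f v = 2 + g (K \ U) v := fun v hv hv' => by simp [hf, hv, hv']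
  have f3 : ∀ v, v ∉ K → f v = K.card + (g' P (A v) * (k - 1) + g (A v) v) := fun v hv => by
    have hvU : v ∉ U := fun h => hv (hpairK h)
    simp [hf, hv, hvU]
  have b1 : ∀ v ∈ U, f v < 2 := fun v hv => by rw [f1 v hv, ← hpair]; exact (hg U).2 v hv
  have b2 : ∀ v ∈ K, v ∉ U → 2 ≤ f v ∧ f v < K.card := fun v hv hv' => by
    have := (hg (K \ U)).2 v (Finset.mem_sdiff.2 ⟨hv, hv'⟩)
    rw [f2 v hv hv']
    omega
  have hin : ∀ v, v ∉ K → g (A v) v < k - 1 := fun v hv => by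
    have h1 := (hg (A v)).2 v (hA v hv).1
    have h2 := (hA v hv).2.1
    omega
  have b3 : ∀ v, v ∉ K → K.card ≤ f v ∧ f v < n := fun v hv => by
    have h1 := hin v hv
    have h2 : g' P (A v) + 1 ≤ P.card := (hg' P).2 _ (hAP v hv)
    have h3 := Nat.mul_le_mul_right (k - 1) h2
    rw [Nat.add_mul, Nat.one_mul] at h3
    rw [f3 v hv]
    omega
  have hU_iff : ∀ v, v ∈ U ↔ f v < 2 := by
    intro v
    refine ⟨b1 v, fun h => ?_⟩
    by_contra hv
    by_cases hvK : v ∈ K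
    · have := b2 v hvK hv
      omega
    · have := b3 v hvK
      omega
  have hK_iff : ∀ v, v ∈ K ↔ f v < K.card := by
    intro v
    constructor
    · intro hv
      by_cases hvU : v ∈ U
      · have := b1 v hvU
        omega
      · exact (b2 v hv hvU).2
    · intro h
      by_contra hv
      have := b3 v hv
      omega
  have hdiv : ∀ v, v ∉ K → (f v - K.card) / (k - 1) = g' P (A v) := by
    intro v hv
    rw [f3 v hv, Nat.add_sub_cancel_left, Nat.mul_comm,
      Nat.mul_add_div (by omega), Nat.div_eq_of_lt (hin v hv), Nat.add_zero]
  have hinj : Function.Injective f := by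
    intro x y hxy
    by_cases hxU : x ∈ U
    · have hyU : y ∈ U := by rw [hU_iff, ← hxy, ← hU_iff]; exact hxU
      rw [f1 x hxU, f1 y hyU] at hxy
      exact (hg U).1 hxU hyU hxy
    · have hyU : y ∉ U := by rw [hU_iff, ← hxy, ← hU_iff]; exact hxU
      by_cases hxK : x ∈ K
      · have hyK : y ∈ K := by rw [hK_iff, ← hxy, ← hK_iff]; exact hxK
        rw [f2 x hxK hxU, f2 y hyK hyU] at hxy
        exact (hg (K \ U)).1 (by simp [hxK, hxU]) (by simp [hyK, hyU]) (by omega)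
      · have hyK : y ∉ K := by rw [hK_iff, ← hxy, ← hK_iff]; exact hxK
        have h1 : g' P (A x) = g' P (A y) := by rw [← hdiv x hxK, hxy, hdiv y hyK]
        have h2 : A x = A y := (hg' P).1 (hAP x hxK) (hAP y hyK) h1
        rw [f3 x hxK, f3 y hyK, h2] at hxy
        exact (hg (A y)).1 (h2 ▸ (hA x hxK).1) (hA y hyK).1 (by omega)
  have hfn : ∀ v, f v < n := by
    intro v
    by_cases hv : v ∈ K
    · have := (hK_iff v).1 hv
      omega
    · exact (b3 v hv).2
  obtain ⟨e, he⟩ := exists_equiv_of_injective hn hinj hfn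
  have hs : c + 1 - k = K.card := by omega
  have hs' : c - k + 1 = K.card := by omega
  refine ⟨hk2, by omega, by omega, by omega, ?_, ⟨e, ?_⟩⟩
  · rw [hs', show n - K.card = (Kᶜ).card by omega, hPc]
    exact Nat.dvd_mul_left _ _
  intro x y
  have hb0 : ∀ v ∈ K, blockZ k c (f v) = 0 := by
    intro v hv
    have := (hK_iff v).1 hv
    rw [blockZ, hs, if_pos this]
  have hb1 : ∀ v, v ∉ K → blockZ k c (f v) = g' P (A v) + 1 := by
    intro v hv
    have := (b3 v hv).1
    rw [blockZ, hs, if_neg (by omega), hdiv v hv]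
  simp only [graphZ, he, ne_eq, EmbeddingLike.apply_eq_iff_eq]
  rw [← hU_iff, ← hU_iff]
  have hUmem : ∀ z, z ∈ U ↔ z = u ∨ z = w := by simp [hU]
  by_cases hxy : x = y
  · subst hxy
    simp
  by_cases hxK : x ∈ K
  · by_cases hyK : y ∈ K
    · have : G.Adj x y := hK hxK hyK hxy
      simp [this, hxy, hb0 x hxK, hb0 y hyK]
    · rw [adj_comm, hadj y hyK x hxK, ← hUmem, hb0 x hxK, hb1 y hyK]
      have := @hpairK y
      simp only [hxy, not_false_eq_true, true_and]
      constructor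
      · rintro (h | h | h)
        · exact h
        · exact absurd (this h) hyK
        · omega
      · exact Or.inl
  · by_cases hyK : y ∈ K
    · rw [hadj x hxK y hyK, ← hUmem, hb1 x hxK, hb0 y hyK]
      have := @hpairK x
      simp only [hxy, not_false_eq_true, true_and]
      constructor
      · rintro (h | h | h)
        · exact absurd (this h) hxK
        · exact h
        · omega
      · exact fun h => Or.inr (Or.inl h)
    · rw [hAadj x hxK y hyK hxy, hb1 x hxK, hb1 y hyK]
      simp only [hxy, not_false_eq_true, true_and]
      constructor
      · rintro (h | h | h)
        · exact absurd (hpairK h) hxK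
        · exact absurd (hpairK h) hyK
        · exact (hg' P).1 (hAP x hxK) (hAP y hyK) (by omega)
      · intro h
        rw [h]
        exact Or.inr (Or.inr rfl)

/-! ### Assembling the two cases -/

namespace NearClique

variable [Fintype V] {Cs K : Finset V} {k c : ℕ} (h : NearClique G Cs K k c)

theorem exists_isComp {x : V} (hx : x ∉ Cs) : ∃ H, x ∈ H ∧ IsComp G Cs H := by
  obtain ⟨H, hHS, hxH, hconn, hcl⟩ := exists_component (G := G) Csᶜ (Finset.mem_compl.2 hx)
  refine ⟨H, hxH, ⟨x, hxH⟩, fun v hv => Finset.mem_compl.1 (hHS hv), hconn, fun v hv w hvw => ?_⟩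
  by_cases hw : w ∈ Cs
  · exact Or.inr hw
  · exact Or.inl (hcl v hv w (Finset.mem_compl.2 hw) hvw)

include h

/-- In both descriptions of a component all attachments lie in `K`. Hence missed vertices have no
neighbours off the cycle, and the minimum degree must be met on it. -/
theorem mem_of_adj_of_not_mem {z y : V} (hz : z ∉ Cs) (hy : y ∈ Cs) (hzy : G.Adj z y) : y ∈ K := by
  obtain ⟨H, hzH, hH⟩ := exists_isComp (G := G) hz
  rcases Nat.lt_or_ge H.card 2 with h1 | h2
  · obtain ⟨x, rfl⟩ := Finset.card_eq_one.1
      (show H.card = 1 by have := Finset.card_pos.2 ⟨z, hzH⟩; omega)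
    rw [Finset.mem_singleton] at hzH
    subst hzH
    exact (h.missed_of_isolated hH).2.2.2.1 (Finset.mem_filter.2 ⟨hy, hzy⟩)
  · obtain ⟨hHk, hHK, u, hu, w, hw, huw, hadj⟩ := h.comp_structure hH h2
    obtain ⟨huK, hwK, -⟩ := h.missed_of_comp hH h2 hHk hHK hu hw huw
      (fun v hv => ⟨(hadj v hv).1, (hadj v hv).2.1⟩)
    rcases (hadj z hzH).2.2 y hy hzy with rfl | rfl <;> assumption

theorem isW_or_isZ {n : ℕ} (hn : Fintype.card V = n) (hcn : c < n) : IsW G n k c ∨ IsZ G n k c := by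
  have hCK : (Cs \ K).card + K.card = c := by
    rw [Finset.card_sdiff_add_card_eq_card h.subset, h.card_eq]
  by_cases hiso : ∃ x, IsComp G Cs {x}
  · left
    obtain ⟨x, hx⟩ := hiso
    obtain ⟨hUk, hMk, hk2, hUK, hnb⟩ := h.missed_of_isolated hx
    -- A larger component would make two missed vertices adjacent, but beside an isolated vertex all
    -- neighbours of a missed vertex on the cycle lie in `K`.
    have hsingle : ∀ H, IsComp G Cs H → H.card < 2 := by
      intro H hH
      by_contra! h2
      obtain ⟨hHk, hHK, u, hu, w, hw, huw, hadj⟩ := h.comp_structure hH h2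
      obtain ⟨-, -, -, -, y, hy, z, hz, hyz⟩ := h.missed_of_comp hH h2 hHk hHK hu hw huw
        (fun v hv => ⟨(hadj v hv).1, (hadj v hv).2.1⟩)
      exact (Finset.mem_sdiff.1 hz).2 (hUK (hnb y hy z (Finset.mem_sdiff.1 hz).1 hyz))
    have hcomp : ∀ z, z ∉ Cs → IsComp G Cs {z} := by
      intro z hz
      obtain ⟨H, hzH, hH⟩ := exists_isComp (G := G) hz
      have := hsingle H hH
      obtain ⟨t, rfl⟩ := Finset.card_eq_one.1
        (show H.card = 1 by have := Finset.card_pos.2 ⟨z, hzH⟩; omega)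
      rw [Finset.mem_singleton] at hzH
      exact hzH ▸ hH
    -- The neighbours of a missed vertex lie in the k-set N_C(z), so they fill it. Comparison with
    -- one fixed missed vertex then shows that all these k-sets coincide.
    have hmissed : ∀ z, z ∉ Cs → ∀ y ∈ Cs \ K, ∀ t, G.Adj y t ↔ t ∈ Cs.filter (G.Adj z) := by
      intro z hz y hy
      obtain ⟨hUk', -, -, -, hnb'⟩ := h.missed_of_isolated (hcomp z hz)
      have hy' := Finset.mem_sdiff.1 hy
      have hsub : ∀ t ∈ Finset.univ, G.Adj y t → t ∈ Cs.filter (G.Adj z) := by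
        intro t _ hyt
        by_cases ht : t ∈ Cs
        · exact hnb' y hy t ht hyt
        · exact absurd (h.mem_of_adj_of_not_mem ht hy'.1 hyt.symm) hy'.2
      have := adj_of_card_le_degIn hsub (by rw [hUk']; exact h.le_degIn y)
      exact fun t => ⟨hsub t (Finset.mem_univ t), this t⟩
    obtain ⟨y, hy⟩ := Finset.card_pos.1 (show 0 < (Cs \ K).card by omega)
    have hUcard := Finset.card_le_card hUK
    refine isW_of_neighbors hn h.isClique (by omega) hUK hUk (by omega) ?_
    have hxCs : x ∉ Cs := hx.2.1 x (by simp)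
    intro v hv z
    by_cases hvC : v ∈ Cs
    · exact hmissed x hxCs v (Finset.mem_sdiff.2 ⟨hvC, hv⟩) z
    · rw [← hmissed x hxCs y hy z, hmissed v hvC y hy z, Finset.mem_filter]
      refine ⟨fun hvz => ⟨?_, hvz⟩, And.right⟩
      rcases (hcomp v hvC).2.2.2 v (by simp) z hvz with hz | hz
      · rw [Finset.mem_singleton] at hz
        exact absurd hz.symm hvz.ne
      · exact hz
  · right
    have hlarge : ∀ H, IsComp G Cs H → 2 ≤ H.card := by
      intro H hH
      by_contra! hlt
      obtain ⟨x, rfl⟩ := Finset.card_eq_one.1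
        (show H.card = 1 by have := hH.1.card_pos; omega)
      exact hiso ⟨x, hH⟩
    have hstr : ∀ H, IsComp G Cs H → H.card + 1 = k ∧ G.IsClique H ∧
        ∃ u ∈ K, ∃ w ∈ K, u ≠ w ∧ (∀ v ∈ H, ∀ z ∈ Cs, G.Adj v z ↔ z = u ∨ z = w) ∧
        (Cs \ K).card + 1 = k ∧ G.IsClique (Cs \ K : Finset V) ∧
        ∀ v ∈ Cs \ K, ∀ z, z ∉ Cs \ K → (G.Adj v z ↔ z = u ∨ z = w) := by
      intro H hH
      obtain ⟨hHk, hHK, u, hu, w, hw, huw, hadj⟩ := h.comp_structure hH (hlarge H hH)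
      obtain ⟨huK, hwK, hMk, hMnb, -⟩ := h.missed_of_comp hH (hlarge H hH) hHk hHK hu hw huw
        (fun v hv => ⟨(hadj v hv).1, (hadj v hv).2.1⟩)
      have hMnb' : ∀ y ∈ Cs \ K, ∀ z, G.Adj y z → z ∈ insert u (insert w (Cs \ K)) := by
        intro y hy z hyz
        have hy' := Finset.mem_sdiff.1 hy
        by_cases hz : z ∈ Cs
        · rw [Finset.mem_insert, Finset.mem_insert]
          have := hMnb y hy z hz hyz
          tauto
        · exact absurd (h.mem_of_adj_of_not_mem hz hy'.1 hyz.symm) hy'.2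
      obtain ⟨hMclq, hMadj⟩ := isClique_of_card_lt_degIn (G := G) (A := Cs \ K) (x := u) (y := w)
        (by
          intro v hv
          rw [hMk]
          refine (h.le_degIn v).trans (Finset.card_le_card fun z hz => ?_)
          rw [Finset.mem_filter] at hz ⊢
          exact ⟨hMnb' v hv z hz.2, hz.2⟩)
      refine ⟨hHk, hHK, u, huK, w, hwK, huw, ?_, hMk, hMclq, ?_⟩
      · intro v hv z hz
        refine ⟨(hadj v hv).2.2 z hz, ?_⟩
        rintro (rfl | rfl)
        · exact (hadj v hv).1
        · exact (hadj v hv).2.1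
      · intro v hv z hz
        constructor
        · intro hvz
          have := hMnb' v hv z hvz
          rw [Finset.mem_insert, Finset.mem_insert] at this
          tauto
        · rintro (rfl | rfl)
          · exact (hMadj v hv).1
          · exact (hMadj v hv).2.1
    obtain ⟨x, hx⟩ : ∃ x, x ∉ Cs := by
      by_contra! hall
      have : Cs = Finset.univ := Finset.eq_univ_of_forall hall
      have h1 := h.card_eq
      rw [this, Finset.card_univ] at h1
      omega
    obtain ⟨H, hxH, hH⟩ := exists_isComp (G := G) hx
    obtain ⟨hHk, -, u, hu, w, hw, huw, -, hMk, hMclq, hMnb⟩ := hstr H hH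
    have h2 := hlarge H hH
    -- The neighbours in `K` of this missed vertex are the two attachments of every component, so
    -- all components share the same pair.
    obtain ⟨y, hy⟩ := Finset.card_pos.1 (show 0 < (Cs \ K).card by omega)
    have hKM : ∀ z ∈ K, z ∉ Cs \ K := fun z hz hz' => (Finset.mem_sdiff.1 hz').2 hz
    refine isZ_of_cliques hn h.isClique (by omega) hu hw huw
      ⟨x, fun hxK => hx (h.subset hxK)⟩ ?_ ?_
    · intro v hv z hz
      by_cases hvC : v ∈ Cs
      · exact hMnb v (Finset.mem_sdiff.2 ⟨hvC, hv⟩) z (hKM z hz)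
      · obtain ⟨H', hvH', hH'⟩ := exists_isComp (G := G) hvC
        obtain ⟨-, -, u', hu', w', hw', -, hadj', -, -, hMnb'⟩ := hstr H' hH'
        rw [hadj' v hvH' z (h.subset hz), ← hMnb' y hy z (hKM z hz), hMnb y hy z (hKM z hz)]
    · intro v hv
      by_cases hvC : v ∈ Cs
      · refine ⟨Cs \ K, Finset.mem_sdiff.2 ⟨hvC, hv⟩, hMk, fun t ht => (Finset.mem_sdiff.1 ht).2,
          hMclq, fun t ht z hz htz => ?_⟩
        by_contra hzM
        rcases (hMnb t ht z hzM).1 htz with rfl | rfl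
        · exact hz hu
        · exact hz hw
      · obtain ⟨H', hvH', hH'⟩ := exists_isComp (G := G) hvC
        obtain ⟨hHk', hHK', -⟩ := hstr H' hH'
        refine ⟨H', hvH', hHk', fun t ht htK => hH'.2.1 t ht (h.subset htK), hHK',
          fun t ht z hz htz => (hH'.2.2.2 t ht z htz).resolve_right fun hzC => ?_⟩
        exact hz (h.mem_of_adj_of_not_mem (hH'.2.1 t ht) hzC htz)

end NearClique

/-- If `z` is in `B`, connectedness suffices; otherwise a walk that leaves `B` in the graph without
`z` provides the edge. -/
theorem TwoConnected.exists_adj [Fintype V] (hG : TwoConnected G) (B : Finset V) (hB : B.Nonempty)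
    (z : V) (hz : ∃ u, u ∉ B ∧ u ≠ z) : ∃ v ∈ B, ∃ w, w ∉ B ∧ w ≠ z ∧ G.Adj v w := by
  obtain ⟨u, hu, huz⟩ := hz
  by_cases hzB : z ∈ B
  · obtain ⟨p⟩ := hG.2.1.preconnected z u
    obtain ⟨d, -, hd1, hd2⟩ := p.exists_boundary_dart (B : Set V) (by simpa using hzB)
      (by simpa using hu)
    exact ⟨d.fst, hd1, d.snd, hd2, fun he => hd2 (by rw [he]; exact_mod_cast hzB), d.adj⟩
  · obtain ⟨v, hv⟩ := hB
    have hvz : v ≠ z := fun he => hzB (he ▸ hv)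
    obtain ⟨p⟩ := (hG.2.2 z).preconnected ⟨v, hvz⟩ ⟨u, huz⟩
    obtain ⟨d, -, hd1, hd2⟩ := p.exists_boundary_dart {t | t.val ∈ B} hv hu
    exact ⟨d.fst.val, hd1, d.snd.val, hd2, d.snd.2, d.adj⟩

theorem IsLocallyMaximalCycle.nearClique [Fintype V] [DecidableRel G.Adj] {k : ℕ}
    (hG : TwoConnected G) (hdeg : k ≤ G.minDegree) {v : V} {C : G.Walk v v}
    (hC : IsLocallyMaximalCycle C) {K : Finset V} (hK : G.IsClique K)
    (hKC : ∀ x ∈ K, x ∈ vertexSet C) (hcard : C.length + 1 ≤ K.card + k) :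
    NearClique G (Finset.univ.filter (· ∈ vertexSet C)) K k C.length := by
  have hcoe : ((Finset.univ.filter (· ∈ vertexSet C) : Finset V) : Set V) = vertexSet C := by
    ext x
    simp
  have hlist := IsCyclicListing.of_isCycle hC.1
  have h3 := hC.1.three_le_length
  have hKsub : K ⊆ Finset.univ.filter (· ∈ vertexSet C) := fun x hx => by simpa using hKC x hx
  have hCs : (Finset.univ.filter (· ∈ vertexSet C)).card = C.length := by
    rw [← Finset.card_range C.length, ← hlist.card_image (by simp)]
    congr 1
    ext x
    simp [hlist.mem x]
  refine ⟨h3, ?_, hCs, ?_, hK, hKsub, ?_, ?_, hG.exists_adj⟩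
  · intro w hw
    rw [hcoe]
    obtain ⟨i, hi, hiw⟩ := (hlist.mem w).1 (by simpa using hw)
    exact ⟨_, hlist.rotate (by omega) i, by simpa using hiw⟩
  · intro S hS x y u w p hP hxu hyw huw q hQ
    rw [hcoe] at hQ
    have := hC.add_le (S := S) (fun s hs hs' => hS s (by exact_mod_cast hs) (by simpa using hs'))
      hP hQ huw hxu hyw
    omega
  · have := Finset.card_sdiff_add_card_eq_card hKsub
    omega
  · intro x
    have h1 := hdeg.trans (G.minDegree_le_degree x)
    rw [← G.card_neighborFinset_eq_degree] at h1
    refine h1.trans (Finset.card_le_card fun y hy => ?_)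
    simpa using hy

end Circumference

theorem lemma4p4 {V : Type*} [Fintype V] (G : SimpleGraph V) [DecidableRel G.Adj]
    (n k c : ℕ) (hn : Fintype.card V = n)
    (hconn : Circumference.TwoConnected G) (hdeg : k ≤ G.minDegree)
    (v : V) (C : G.Walk v v) (hC : Circumference.IsLocallyMaximalCycle C)
    (hlen : C.length = c) (hc : c ≤ n - 1)
    (hclique : (c : ℤ) - k + 1 ≤ (G.induce (Circumference.vertexSet C)).cliqueNum) :
    Circumference.IsW G n k c ∨ Circumference.IsZ G n k c := by
  classical
  subst hlen
  have h3 := hC.1.three_le_length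
  obtain ⟨s, hs⟩ := (G.induce (Circumference.vertexSet C)).exists_isNClique_cliqueNum
  have hK : G.IsClique (s.map (Function.Embedding.subtype _) : Finset V) := by
    intro x hx y hy hxy
    simp only [Finset.coe_map, Function.Embedding.subtype_apply, Set.mem_image,
      Finset.mem_coe] at hx hy
    obtain ⟨x, hx, rfl⟩ := hx
    obtain ⟨y, hy, rfl⟩ := hy
    exact hs.1 hx hy (fun h => hxy (congrArg Subtype.val h))
  -- A cycle has length at least 3, so the truncated `n - 1` still gives c < n.
  refine (hC.nearClique hconn hdeg hK ?_ ?_).isW_or_isZ hn (by omega)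
  · intro x hx
    obtain ⟨y, -, rfl⟩ := Finset.mem_map.1 hx
    exact y.2
  · rw [Finset.card_map, hs.2]
    omega
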